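/- Let $\alpha\in(0,2]$, and for a real random variable $Z$ put $\|Z\|_{\psi_\alpha}=\inf\{t>0:\mathbb E[\exp(|Z|^\alpha/t^\alpha)]\le 2\}$. There are constants $c_5,c_6,c_7,c_8>0$ depending only on $\alpha$ such that the following holds. Let $n,p\ge 1$ be integers, $\kappa>0$, $\eta\in[0,1]$, $\mu\in\mathbb R^p$, and let $U\in\mathbb R^{p\times p}$ be orthogonal. Let $P_{\mathrm{clust}}=P^{(1)}\times\cdots\times P^{(p)}$ be a product probability distribution on $\mathbb R^p$ whose marginals have mean zero and $\psi_\alpha$-norm at most $1$, with $\mathbb E_{q\sim P_{\mathrm{clust}}}\|q\|^2\ge\kappa p$. Let $\tilde P$ be the distribution of $(Uq+\tilde y\mu,\tilde y)$, where $q\sim P_{\mathrm{clust}}$ and $\tilde y\sim\mathrm{Uniform}(\{\pm1\})$ are independent, and let $P$ be a probability distribution on $\mathbb R^p\times\{\pm1\}$ that has the same marginals on $\mathbb R^p$ and on $\{\pm1\}$ as $\tilde P$ and total variation distance at most $\eta$ from $\tilde P$. Let $(x_1,y_1),\dots,(x_n,y_n)$ be independent samples from $P$ and let $X=[y_1x_1,\dots,y_nx_n]\in\mathbb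 R^{p\times n}$. Then for every $\delta>0$, with probability at least $1-\delta$, the largest singular value of $X$ satisfies $$s_1(X)\le\sqrt p\left(c_5+\frac{c_6\sqrt n}{p}\sum_{i=1}^p|\mu_i|+\frac{2n\|\mu\|^2}{p}+\frac{c_7+c_8\max_i|\mu_i|\sqrt n}{p}\Bigl(n\log 9+\log\frac4\delta\Bigr)^{2/\alpha}\right).$$ -/

import Mathlib

open MeasureTheory ProbabilityTheory
open scoped ENNReal

noncomputable section

/-- The exponential Orlicz norm `‖X‖_{ψ_α} = inf {t > 0 : E[exp(|X|^α / t^α)] ≤ 2}` of a real random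
variable `X` under `P`, as an extended nonnegative number (it is `∞` if there is no such `t`). -/
def orliczNorm {Ω : Type*} [MeasurableSpace Ω] (α : ℝ) (X : Ω → ℝ) (P : Measure Ω) : ℝ≥0∞ :=
  sInf (ENNReal.ofReal ''
    {t : ℝ | 0 < t ∧ ∫⁻ ω, ENNReal.ofReal (Real.exp (|X ω| ^ α / t ^ α)) ∂P ≤ 2})

/-- Total variation distance `sup_A |P(A) - Q(A)|` of two probability measures. -/
def totalVariationDist {E : Type*} [MeasurableSpace E] (P Q : Measure E) : ℝ :=
  ⨆ A : {A : Set E // MeasurableSet A}, |P.real A.1 - Q.real A.1|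

/-- Every set of labels is measurable. -/
instance instDiscreteMeasurableSpaceLabel : DiscreteMeasurableSpace ℤˣ where
  forall_measurableSet s :=
    ⟨Units.val '' s, MeasurableSet.of_discrete, Set.preimage_image_eq s Units.val_injective⟩

/-- The label `±1` as a real number. -/
def labelVal (y : ℤˣ) : ℝ := ((y : ℤ) : ℝ)

/-- The uniform distribution on `{±1}`. -/
def uniformLabel : Measure ℤˣ := (PMF.uniformOfFintype ℤˣ).toMeasure

/-- Admissible marginals `ν 1, …, ν p` of the product distribution `P_clust`: mean-zero probability
measures on `ℝ` with `ψ_α`-norm at most `1`, such that `E‖q‖² ≥ κ p` for `q ∼ ν 1 × ⋯ × ν p`. -/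
structure IsClusterFamily (α κ : ℝ) {p : ℕ} (ν : Fin p → Measure ℝ) : Prop where
  isProbabilityMeasure : ∀ j, IsProbabilityMeasure (ν j)
  integrable : ∀ j, Integrable (fun x : ℝ => x) (ν j)
  mean_zero : ∀ j, ∫ x, x ∂(ν j) = 0
  orlicz_le : ∀ j, orliczNorm α (fun x : ℝ => x) (ν j) ≤ 1
  second_moment : κ * p ≤ ∫ q : Fin p → ℝ, ‖(WithLp.toLp 2 q : EuclideanSpace ℝ (Fin p))‖ ^ 2
    ∂(Measure.pi ν)

/-- The clean distribution: the law of `(U q + ỹ μ, ỹ)`, where `q ∼ ν 1 × ⋯ × ν p` and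
`ỹ ∼ Uniform {±1}` are independent. -/
def cleanLaw {p : ℕ} (ν : Fin p → Measure ℝ) (U : Matrix (Fin p) (Fin p) ℝ)
    (μ : EuclideanSpace ℝ (Fin p)) : Measure (EuclideanSpace ℝ (Fin p) × ℤˣ) :=
  ((Measure.pi ν).prod uniformLabel).map
    (fun z => (WithLp.toLp 2 (U.mulVec z.1) + labelVal z.2 • μ, z.2))

/-- `P` is a noisy version of the distribution `Pc`, with noise level `η`: it is a probability
measure with the same marginals (of the input and of the label) as `Pc`, and the total variation
distance between the two is at most `η`. -/
structure IsNoisyVersion {E : Type*} [MeasurableSpace E] (η : ℝ) (Pc P : Measure (E × ℤˣ)) :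
    Prop where
  isProbabilityMeasure : IsProbabilityMeasure P
  map_fst : P.map Prod.fst = Pc.map Prod.fst
  map_snd : P.map Prod.snd = Pc.map Prod.snd
  totalVariation_le : totalVariationDist P Pc ≤ η

/-- The data matrix `[y_1 x_1, …, y_n x_n] ∈ ℝ^{p × n}`. -/
def dataMatrix {n p : ℕ} (S : Fin n → EuclideanSpace ℝ (Fin p) × ℤˣ) :
    Matrix (Fin p) (Fin n) ℝ :=
  Matrix.of fun i k => labelVal (S k).2 * (S k).1 i

/-- The largest singular value `s_1(A)` of a real matrix. Mathlib's singular values of a linear map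
between inner product spaces are listed in decreasing order, starting from the index `0`. -/
def topSingularValue {m n : ℕ} (A : Matrix (Fin m) (Fin n) ℝ) : ℝ :=
  (Matrix.toEuclideanLin A).singularValues 0

end

/-!
Flipping the signs of its columns does not change the singular values of a matrix, so it suffices to
bound the operator norm of `[x 1, …, x n]`, whose columns are distributed as `U q + ỹ μ`. For a
vector `v` in the unit ball of `ℝⁿ`, the signal contributes at most `√n ‖μ‖` to `‖∑ k, v k • x k‖`
by Cauchy–Schwarz, and the noise contributes `(∑ j, (∑ k, v k * q k j) ^ 2) ^ (1/2)` because `U` is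
an isometry.

Each inner sum is again sub-Weibull of order `α`, with constants that depend only on `α`: truncate
the variables `v k * q k j` at the level `t` and apply Chernoff's bound with a parameter of order
`t ^ (α - 1)`. The inner sums are independent in `j`; truncating them at a level `t` with
`t ^ α ≍ L + log p` and applying Chernoff's bound to their squares, with a parameter of order
`t ^ (α - 2)`, bounds the sum of the squares by `O(p + L ^ (2/α))` with probability `1 - exp (-L)`.
The contribution of `log p` is absorbed since `(log p) ^ (2/α) = O(p)`.

A union bound over a `1/2`-net of at most `5 ^ n` points, with `L = n log 9 + log (4/δ)`, turns this
into a bound on the operator norm, and `2 √n ‖μ‖ ≤ √p (1 + n ‖μ‖² / p)` by AM–GM.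
-/

section Elementary

variable {α c M θ v t : ℝ}

theorem exp_le_one_add_mul_exp (y : ℝ) : Real.exp y ≤ 1 + y * Real.exp y := by
  have h := mul_le_mul_of_nonneg_right (Real.one_sub_le_exp_neg y) (Real.exp_pos y).le
  rw [← Real.exp_add, neg_add_cancel, Real.exp_zero] at h
  linarith

theorem exp_le_one_add_add_sq_mul_exp_abs (y : ℝ) :
    Real.exp y ≤ 1 + y + y ^ 2 * Real.exp |y| := by
  have h : |Real.exp y - (1 + y)| ≤ y ^ 2 * Real.exp |y| := by
    have h' := Complex.norm_exp_sub_sum_le_norm_mul_exp y 2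
    norm_num [Finset.sum_range_succ] at h'
    exact_mod_cast h'
  linarith [le_abs_self (Real.exp y - (1 + y))]

theorem exists_sq_le_mul_exp_rpow (hα : 0 < α) (hc : 0 < c) :
    ∃ M : ℝ, 1 ≤ M ∧ ∀ x : ℝ, x ^ 2 ≤ M * Real.exp (c * |x| ^ α) := by
  set a : ℝ := 2 / (α * c) with ha
  refine ⟨max 1 (a ^ (2 / α)), le_max_left _ _, fun x => ?_⟩
  have hle : |x| ^ α / a ≤ Real.exp (|x| ^ α / a) := by
    linarith [Real.add_one_le_exp (|x| ^ α / a)]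
  calc x ^ 2 = (|x| ^ α) ^ (2 / α) := by
        rw [← Real.rpow_mul (abs_nonneg x), mul_div_cancel₀ _ hα.ne', Real.rpow_two, sq_abs]
    _ = a ^ (2 / α) * (|x| ^ α / a) ^ (2 / α) := by
        rw [← Real.mul_rpow (by positivity) (by positivity), mul_div_cancel₀ _ (by positivity)]
    _ ≤ a ^ (2 / α) * Real.exp (|x| ^ α / a) ^ (2 / α) := by gcongr
    _ = a ^ (2 / α) * Real.exp (c * |x| ^ α) := by
        rw [← Real.exp_mul, ha]
        congr 2
        field_simp
    _ ≤ max 1 (a ^ (2 / α)) * Real.exp (c * |x| ^ α) := by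
        gcongr
        exact le_max_right _ _

theorem abs_mul_rpow_sub_one_mul_le {y : ℝ} (hα : 0 < α) (hα2 : α ≤ 2) (hv : |v| ≤ 1)
    (hy : 0 ≤ y) (ht : 0 < t) (hvy : |v| * y ≤ t) :
    |v| * y * t ^ (α - 1) ≤ 4 * y ^ α + v ^ 2 * t ^ α / 4 := by
  -- For `α ≤ 1` the first term alone dominates; for `1 ≤ α` the second one does as long as
  -- `y ≤ t |v| / 4`, and the first one beyond.
  have hvt : 0 ≤ v ^ 2 * t ^ α / 4 := by positivity
  have hyα : 0 ≤ y ^ α := by positivity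
  have ht' : t ^ (α - 1) * t = t ^ α := by
    rw [Real.rpow_sub_one ht.ne', div_mul_cancel₀ _ ht.ne']
  rcases le_total α 1 with hα1 | hα1
  · rcases (by positivity : 0 ≤ |v| * y).eq_or_lt with hw | hw
    · rw [← hw, zero_mul]
      positivity
    · have hle : |v| * y * t ^ (α - 1) ≤ y ^ α :=
        calc |v| * y * t ^ (α - 1) ≤ |v| * y * (|v| * y) ^ (α - 1) := by
              gcongr 1
              exact Real.rpow_le_rpow_of_nonpos hw hvy (by linarith)
          _ = (|v| * y) ^ α := by
              rw [Real.rpow_sub_one hw.ne', mul_div_cancel₀ _ hw.ne']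
          _ ≤ y ^ α := by
              gcongr
              exact mul_le_of_le_one_left hy hv
      linarith
  · rcases le_total y (t * |v| / 4) with hyt | hyt
    · have hle : |v| * y * t ^ (α - 1) ≤ v ^ 2 * t ^ α / 4 :=
        calc |v| * y * t ^ (α - 1) ≤ |v| * (t * |v| / 4) * t ^ (α - 1) := by gcongr
          _ = v ^ 2 * t ^ α / 4 := by rw [← ht', ← sq_abs v]; ring
      linarith
    · have hvα : |v| ≤ |v| ^ (α - 1) :=
        Real.self_le_rpow_of_le_one (abs_nonneg v) hv (by linarith)
      have h4 : (4 : ℝ) ^ (α - 1) ≤ 4 := by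
        simpa using Real.rpow_le_rpow_of_exponent_le (by norm_num : (1 : ℝ) ≤ 4)
          (by linarith : α - 1 ≤ 1)
      have hle : |v| * y * t ^ (α - 1) ≤ 4 * y ^ α :=
        calc |v| * y * t ^ (α - 1) ≤ |v| ^ (α - 1) * y * t ^ (α - 1) := by gcongr
          _ = (|v| * t) ^ (α - 1) * y := by rw [Real.mul_rpow (abs_nonneg v) ht.le]; ring
          _ ≤ (4 * y) ^ (α - 1) * y := by
              refine mul_le_mul_of_nonneg_right ?_ hy
              exact Real.rpow_le_rpow (by positivity) (by linarith) (by linarith)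
          _ = 4 ^ (α - 1) * (y ^ (α - 1) * y) := by rw [Real.mul_rpow (by norm_num) hy]; ring
          _ ≤ 4 * y ^ α := by
              rw [← Real.rpow_add_one' hy (by linarith), sub_add_cancel]
              gcongr
      linarith

theorem abs_rpow_mul_truncation_le {β : Type*} {f : β → ℝ} (hα : 0 < α) (hα2 : α ≤ 2)
    (hv : |v| ≤ 1) (ht : 0 < t) (x : β) :
    |t ^ (α - 1) * truncation (fun x => v * f x) t x| ≤ 4 * |f x| ^ α + v ^ 2 * t ^ α / 4 := by
  rcases le_or_gt |v * f x| t with h | h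
  · calc |t ^ (α - 1) * truncation (fun x => v * f x) t x|
        = |truncation (fun x => v * f x) t x| * t ^ (α - 1) := by
          rw [abs_mul, abs_of_nonneg (by positivity), mul_comm]
      _ ≤ |v| * |f x| * t ^ (α - 1) := by
          rw [← abs_mul]
          exact mul_le_mul_of_nonneg_right (abs_truncation_le_abs_self _ _ _) (by positivity)
      _ ≤ _ := abs_mul_rpow_sub_one_mul_le hα hα2 hv (abs_nonneg _) ht (by rwa [← abs_mul])
  · have hW : truncation (fun x => v * f x) t x = 0 :=
      Set.indicator_of_notMem (fun hmem => h.not_ge (abs_le.2 ⟨hmem.1.le, hmem.2⟩)) _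
    rw [hW, mul_zero, abs_zero]
    positivity

theorem exp_mul_truncation_le {β : Type*} {f : β → ℝ} (hα : 0 < α) (hα2 : α ≤ 2)
    (hM : ∀ y : ℝ, y ^ 2 ≤ M * Real.exp (c / 2 * |y| ^ α)) (hθ : 0 ≤ θ) (hθc : θ ≤ c / 8)
    (hv : |v| ≤ 1) (ht : 0 < t) (x : β) :
    Real.exp (θ * t ^ (α - 1) * truncation (fun x => v * f x) t x)
      ≤ 1 + θ * t ^ (α - 1) * truncation (fun x => v * f x) t x
        + (θ * t ^ (α - 1)) ^ 2 * v ^ 2 * M * Real.exp (θ * (v ^ 2 * t ^ α / 4))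
          * Real.exp (c * |f x| ^ α) := by
  set W := truncation (fun x => v * f x) t x
  set r := θ * t ^ (α - 1) with hr
  have hsq : W ^ 2 ≤ v ^ 2 * (M * Real.exp (c / 2 * |f x| ^ α)) :=
    calc W ^ 2 ≤ (v * f x) ^ 2 := sq_le_sq.2 (abs_truncation_le_abs_self _ _ _)
      _ ≤ v ^ 2 * (M * Real.exp (c / 2 * |f x| ^ α)) := by rw [mul_pow]; gcongr; exact hM _
  have hexponent : |r * W| ≤ θ * (v ^ 2 * t ^ α / 4) + c / 2 * |f x| ^ α :=
    calc |r * W| = θ * |t ^ (α - 1) * W| := by rw [hr, mul_assoc, abs_mul, abs_of_nonneg hθ]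
      _ ≤ θ * (4 * |f x| ^ α + v ^ 2 * t ^ α / 4) := by
          gcongr
          exact abs_rpow_mul_truncation_le hα hα2 hv ht x
      _ = θ * (v ^ 2 * t ^ α / 4) + 4 * θ * |f x| ^ α := by ring
      _ ≤ θ * (v ^ 2 * t ^ α / 4) + c / 2 * |f x| ^ α := by
          gcongr
          linarith
  calc Real.exp (r * W) ≤ 1 + r * W + (r * W) ^ 2 * Real.exp |r * W| :=
        exp_le_one_add_add_sq_mul_exp_abs _
    _ ≤ 1 + r * W + r ^ 2 * (v ^ 2 * (M * Real.exp (c / 2 * |f x| ^ α)))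
          * Real.exp (θ * (v ^ 2 * t ^ α / 4) + c / 2 * |f x| ^ α) := by
        rw [mul_pow]
        gcongr 1
        exact mul_le_mul (by gcongr) (Real.exp_le_exp.2 hexponent) (Real.exp_pos _).le
          (mul_nonneg (sq_nonneg r) ((sq_nonneg W).trans hsq))
    _ = _ := by
        rw [Real.exp_add, (by ring : c * |f x| ^ α = c / 2 * |f x| ^ α + c / 2 * |f x| ^ α),
          Real.exp_add]
        ring

theorem one_add_add_mul_exp_le_exp {u s : ℝ} (hu : 0 ≤ u) (hs : 0 ≤ s) :
    1 + u / 8 + u * s / 8 * Real.exp (u * s / 4) ≤ Real.exp (u * (1 + s / 2)) := by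
  have hus : 0 ≤ u * s := by positivity
  have hE : 1 ≤ Real.exp (u * s / 4) := Real.one_le_exp (by positivity)
  calc 1 + u / 8 + u * s / 8 * Real.exp (u * s / 4)
      ≤ (u / 8 + u * s / 8 + 1) * Real.exp (u * s / 4) := by nlinarith
    _ ≤ Real.exp (u / 8 + u * s / 8) * Real.exp (u * s / 4) := by
        gcongr
        exact Real.add_one_le_exp _
    _ ≤ Real.exp (u * (1 + s / 2)) := by
        rw [← Real.exp_add]
        gcongr
        nlinarith

end Elementary

section LayerCake

variable {Ω : Type*} [MeasurableSpace Ω] {P : Measure Ω} [IsProbabilityMeasure P]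

theorem integral_exp_div_two_div_two (w : ℝ) :
    ∫ s in (0 : ℝ)..w, Real.exp (s / 2) / 2 = Real.exp (w / 2) - 1 := by
  simp [intervalIntegral.integral_comp_div]

theorem lintegral_exp_half_le {W : Ω → ℝ} {K : ℝ} (hK : 0 ≤ K) (hW : AEMeasurable W P)
    (hW0 : ∀ ω, 0 ≤ W ω) (h : ∀ s : ℝ, 0 < s → P.real {ω | s ≤ W ω} ≤ K * Real.exp (-s)) :
    ∫⁻ ω, ENNReal.ofReal (Real.exp (W ω / 2)) ∂P ≤ ENNReal.ofReal (1 + K) := by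
  have htail : ∀ s ∈ Set.Ioi (0 : ℝ), P {ω | s ≤ W ω} * ENNReal.ofReal (Real.exp (s / 2) / 2)
      ≤ ENNReal.ofReal (K / 2 * Real.exp (-(1 / 2) * s)) := by
    intro s hs
    rw [← ofReal_measureReal, ← ENNReal.ofReal_mul measureReal_nonneg]
    refine ENNReal.ofReal_le_ofReal ?_
    calc _ ≤ K * Real.exp (-s) * (Real.exp (s / 2) / 2) := by gcongr; exact h s hs
      _ = K / 2 * (Real.exp (-s) * Real.exp (s / 2)) := by ring
      _ = K / 2 * Real.exp (-(1 / 2) * s) := by rw [← Real.exp_add]; ring_nf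
  have hint : IntegrableOn (fun s : ℝ => K / 2 * Real.exp (-(1 / 2) * s)) (Set.Ioi 0) :=
    (integrableOn_exp_mul_Ioi (by norm_num) 0).const_mul _
  calc ∫⁻ ω, ENNReal.ofReal (Real.exp (W ω / 2)) ∂P
      = ∫⁻ ω, (1 + ENNReal.ofReal (∫ s in (0 : ℝ)..W ω, Real.exp (s / 2) / 2)) ∂P := by
        refine lintegral_congr fun ω => ?_
        rw [integral_exp_div_two_div_two, ← ENNReal.ofReal_one, ← ENNReal.ofReal_add zero_le_one
          (sub_nonneg.2 (Real.one_le_exp (div_nonneg (hW0 ω) zero_le_two))), add_sub_cancel]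
    _ = 1 + ∫⁻ s in Set.Ioi 0, P {ω | s ≤ W ω} * ENNReal.ofReal (Real.exp (s / 2) / 2) := by
        rw [lintegral_add_left measurable_const, lintegral_one, measure_univ,
          lintegral_comp_eq_lintegral_meas_le_mul P (ae_of_all _ hW0) hW
            (fun t _ => Continuous.intervalIntegrable (by fun_prop) _ _)
            (ae_of_all _ fun s => by positivity)]
    _ ≤ 1 + ∫⁻ s in Set.Ioi 0, ENNReal.ofReal (K / 2 * Real.exp (-(1 / 2) * s)) := by
        gcongr 1
        exact setLIntegral_mono' measurableSet_Ioi htail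
    _ = ENNReal.ofReal (1 + K) := by
        rw [← ofReal_integral_eq_lintegral_ofReal hint (ae_of_all _ fun s => by positivity),
          integral_const_mul, integral_exp_mul_Ioi (by norm_num), ENNReal.ofReal_add zero_le_one hK,
          ENNReal.ofReal_one]
        norm_num

end LayerCake

/-- `X` is sub-Weibull of order `α` at scale `c` if `E[exp(c |X|^α)] ≤ K`. Keeping `K` free, instead
of normalizing it to `2` as in the Orlicz norm, makes the constants composable. -/
structure IsSubWeibull {Ω : Type*} [MeasurableSpace Ω] (α c K : ℝ) (X : Ω → ℝ) (P : Measure Ω) :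
    Prop where
  aemeasurable : AEMeasurable X P
  lintegral_exp_le : ∫⁻ ω, ENNReal.ofReal (Real.exp (c * |X ω| ^ α)) ∂P ≤ ENNReal.ofReal K

namespace IsSubWeibull

variable {Ω : Type*} [MeasurableSpace Ω] {P : Measure Ω} {α c K : ℝ} {X : Ω → ℝ}

theorem integrable_exp (h : IsSubWeibull α c K X P) :
    Integrable (fun ω => Real.exp (c * |X ω| ^ α)) P := by
  have hX := h.aemeasurable
  refine ⟨(by fun_prop : AEMeasurable _ P).aestronglyMeasurable, ?_⟩
  rw [hasFiniteIntegral_iff_ofReal (ae_of_all _ fun _ => (Real.exp_pos _).le)]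
  exact h.lintegral_exp_le.trans_lt ENNReal.ofReal_lt_top

theorem integral_exp_le (h : IsSubWeibull α c K X P) (hK : 0 ≤ K) :
    ∫ ω, Real.exp (c * |X ω| ^ α) ∂P ≤ K := by
  rw [integral_eq_lintegral_of_nonneg_ae (ae_of_all _ fun _ => (Real.exp_pos _).le)
    h.integrable_exp.aestronglyMeasurable]
  exact ENNReal.toReal_le_of_le_ofReal hK h.lintegral_exp_le

theorem integrable_of_abs_le (h : IsSubWeibull α c K X P) {f : Ω → ℝ} (hf : AEMeasurable f P)
    {a : ℝ} (hfa : ∀ ω, |f ω| ≤ a * Real.exp (c * |X ω| ^ α)) : Integrable f P :=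
  (h.integrable_exp.const_mul a).mono' hf.aestronglyMeasurable (ae_of_all _ hfa)

theorem integral_le_of_le (h : IsSubWeibull α c K X P) (hK : 0 ≤ K) {f : Ω → ℝ}
    (hf : Integrable f P) {a : ℝ} (ha : 0 ≤ a) (hfa : ∀ ω, f ω ≤ a * Real.exp (c * |X ω| ^ α)) :
    ∫ ω, f ω ∂P ≤ a * K :=
  calc ∫ ω, f ω ∂P ≤ ∫ ω, a * Real.exp (c * |X ω| ^ α) ∂P :=
        integral_mono hf (h.integrable_exp.const_mul a) hfa
    _ ≤ a * K := by
        rw [integral_const_mul]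
        gcongr
        exact h.integral_exp_le hK

theorem measureReal_le_mul [IsFiniteMeasure P] (h : IsSubWeibull α c K X P) (hK : 0 ≤ K) {a : ℝ}
    (ha : 0 ≤ a) {s : Set Ω} (hs : ∀ ω ∈ s, 1 ≤ a * Real.exp (c * |X ω| ^ α)) :
    P.real s ≤ a * K := by
  have hmarkov := mul_meas_ge_le_integral_of_nonneg
    (ae_of_all P fun ω => by positivity) (h.integrable_exp.const_mul a) 1
  rw [one_mul] at hmarkov
  exact (measureReal_mono hs).trans (hmarkov.trans
    (h.integral_le_of_le hK (h.integrable_exp.const_mul a) ha fun _ => le_rfl))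

theorem measureReal_abs_ge_le [IsFiniteMeasure P] (h : IsSubWeibull α c K X P) (hα : 0 ≤ α)
    (hc : 0 ≤ c) (hK : 0 ≤ K) {t : ℝ} (ht : 0 ≤ t) :
    P.real {ω | t ≤ |X ω|} ≤ Real.exp (-(c * t ^ α)) * K := by
  refine h.measureReal_le_mul hK (Real.exp_pos _).le fun ω (hω : t ≤ |X ω|) => ?_
  rw [← Real.exp_add]
  refine Real.one_le_exp ?_
  have : c * t ^ α ≤ c * |X ω| ^ α := by gcongr
  linarith

theorem of_measureReal_abs_ge_le [IsProbabilityMeasure P] (hα : 0 < α) (hc : 0 < c) (hK : 0 ≤ K)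
    (hX : AEMeasurable X P)
    (h : ∀ t : ℝ, 0 < t → P.real {ω | t ≤ |X ω|} ≤ K * Real.exp (-(c * t ^ α))) :
    IsSubWeibull α (c / 2) (1 + K) X P := by
  have hW := lintegral_exp_half_le (P := P) (W := fun ω => c * |X ω| ^ α) hK (by fun_prop)
    (fun ω => by positivity) fun s hs => by
      have hset : {ω | s ≤ c * |X ω| ^ α} = {ω | (s / c) ^ α⁻¹ ≤ |X ω|} := by
        ext ω
        change s ≤ c * |X ω| ^ α ↔ (s / c) ^ α⁻¹ ≤ |X ω|
        rw [Real.rpow_inv_le_iff_of_pos (by positivity) (abs_nonneg _) hα, div_le_iff₀' hc]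
      have hP := h _ (Real.rpow_pos_of_pos (div_pos hs hc) α⁻¹)
      rwa [Real.rpow_inv_rpow (by positivity) hα.ne', mul_div_cancel₀ _ hc.ne', ← hset] at hP
  refine ⟨hX, ?_⟩
  simpa only [div_mul_eq_mul_div] using hW

end IsSubWeibull

section Hoeffding

variable {Ω : Type*} [MeasurableSpace Ω] {P : Measure Ω} {α c K M θ t : ℝ}

theorem measureReal_sum_ge_le_exp {ι : Type*} [Fintype ι] {W : ι → Ω → ℝ} (hind : iIndepFun W P)
    (hW : ∀ k, AEMeasurable (W k) P) {s : ℝ} (hs : 0 ≤ s)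
    (hint : ∀ k, Integrable (fun ω => Real.exp (s * W k ω)) P) {a : ι → ℝ}
    (ha : ∀ k, mgf (W k) P s ≤ Real.exp (a k)) (t : ℝ) :
    P.real {ω | t ≤ ∑ k, W k ω} ≤ Real.exp (∑ k, a k - s * t) := by
  have := hind.isProbabilityMeasure
  have hmgf : mgf (∑ k, W k) P s = ∏ k, mgf (W k) P s := hind.mgf_sum₀ hW Finset.univ
  have hint_sum : Integrable (fun ω => Real.exp (s * (∑ k, W k) ω)) P := by
    rw [← mgf_pos_iff, hmgf]
    exact Finset.prod_pos fun k _ => mgf_pos (hint k)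
  simp only [← Finset.sum_apply]
  calc P.real {ω | t ≤ (∑ k, W k) ω}
      ≤ Real.exp (-s * t) * mgf (∑ k, W k) P s := measure_ge_le_exp_mul_mgf t hs hint_sum
    _ ≤ Real.exp (-s * t) * ∏ k, Real.exp (a k) := by
        rw [hmgf]
        gcongr with k
        · exact fun _ _ => mgf_nonneg
        · exact ha k
    _ = Real.exp (∑ k, a k - s * t) := by
        rw [← Real.exp_sum, ← Real.exp_add]
        ring_nf

theorem iIndepFun_truncation {ι : Type*} {Z : ι → Ω → ℝ} (hind : iIndepFun Z P) (t : ℝ) :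
    iIndepFun (fun k => truncation (Z k) t) P :=
  hind.comp (fun _ => (Set.Ioc (-t) t).indicator id) fun _ =>
    measurable_id.indicator measurableSet_Ioc

theorem measureReal_sum_ge_le_truncation {ι : Type*} [Fintype ι] [IsFiniteMeasure P]
    (Z : ι → Ω → ℝ) (φ : ℝ → ℝ) (s t : ℝ) :
    P.real {ω | s ≤ ∑ k, φ (Z k ω)} ≤ P.real {ω | s ≤ ∑ k, φ (truncation (Z k) t ω)}
      + ∑ k, P.real {ω | t ≤ |Z k ω|} := by
  have hsub : {ω | s ≤ ∑ k, φ (Z k ω)}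
      ⊆ {ω | s ≤ ∑ k, φ (truncation (Z k) t ω)} ∪ ⋃ k, {ω | t ≤ |Z k ω|} := by
    intro ω hω
    by_cases hlarge : ∃ k, t ≤ |Z k ω|
    · exact Or.inr (Set.mem_iUnion.2 hlarge)
    · left
      push Not at hlarge
      have hsum : ∑ k, φ (truncation (Z k) t ω) = ∑ k, φ (Z k ω) :=
        Finset.sum_congr rfl fun k _ => by rw [truncation_eq_self (hlarge k)]
      exact hω.trans_eq hsum.symm
  refine (measureReal_mono hsub).trans ((measureReal_union_le _ _).trans ?_)
  gcongr
  exact measureReal_iUnion_fintype_le _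

theorem integral_truncation_le_of_integral_eq_zero [IsFiniteMeasure P] {Z : Ω → ℝ}
    (hZ : MemLp Z 2 P) (hmean : ∫ ω, Z ω ∂P = 0) (ht : 0 < t) :
    ∫ ω, truncation Z t ω ∂P ≤ (∫ ω, Z ω ^ 2 ∂P) / t := by
  have hint := hZ.integrable one_le_two
  have hle : ∀ ω, truncation Z t ω - Z ω ≤ Z ω ^ 2 / t := by
    intro ω
    have h0 : 0 ≤ Z ω ^ 2 / t := by positivity
    rcases lt_or_ge |Z ω| t with h | h
    · rwa [truncation_eq_self h, sub_self]
    · rcases Set.indicator_eq_zero_or_self (Set.Ioc (-t) t) id (Z ω) with h' | h'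
      · have hsq : |Z ω| ≤ Z ω ^ 2 / t := by
          rw [le_div_iff₀ ht, ← sq_abs, sq]
          gcongr
        have hW : truncation Z t ω = 0 := h'
        linarith [neg_le_abs (Z ω)]
      · have hW : truncation Z t ω = Z ω := h'
        rwa [hW, sub_self]
  calc ∫ ω, truncation Z t ω ∂P = ∫ ω, (truncation Z t ω - Z ω) ∂P := by
        rw [integral_sub hZ.aestronglyMeasurable.integrable_truncation hint, hmean, sub_zero]
    _ ≤ ∫ ω, Z ω ^ 2 / t ∂P :=
        integral_mono (hZ.aestronglyMeasurable.integrable_truncation.sub hint)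
          (hZ.integrable_sq.div_const t) hle
    _ = (∫ ω, Z ω ^ 2 ∂P) / t := integral_div _ _

namespace IsSubWeibull

variable {X : Ω → ℝ} {v : ℝ}

theorem memLp_two (h : IsSubWeibull α c K X P)
    (hM : ∀ x : ℝ, x ^ 2 ≤ M * Real.exp (c * |x| ^ α)) : MemLp X 2 P := by
  rw [memLp_two_iff_integrable_sq h.aemeasurable.aestronglyMeasurable]
  refine h.integrable_of_abs_le (a := M) (h.aemeasurable.pow_const 2) fun ω => ?_
  rw [abs_of_nonneg (sq_nonneg _)]
  exact hM _

theorem integral_sq_le (h : IsSubWeibull α c K X P) (hK : 0 ≤ K) (hM0 : 0 ≤ M)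
    (hM : ∀ x : ℝ, x ^ 2 ≤ M * Real.exp (c * |x| ^ α)) : ∫ ω, X ω ^ 2 ∂P ≤ M * K :=
  h.integral_le_of_le hK (h.memLp_two hM).integrable_sq hM0 fun _ => hM _

theorem mgf_truncation_le_one_add [IsProbabilityMeasure P] (h : IsSubWeibull α c K X P)
    (hmean : ∫ ω, X ω ∂P = 0) (hα : 0 < α) (hα2 : α ≤ 2) (hc : 0 ≤ c) (hK : 0 ≤ K) (hM0 : 0 ≤ M)
    (hM : ∀ x : ℝ, x ^ 2 ≤ M * Real.exp (c / 2 * |x| ^ α)) (hθ : 0 ≤ θ) (hθc : θ ≤ c / 8)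
    (hv : |v| ≤ 1) (ht : 0 < t) :
    mgf (truncation (fun ω => v * X ω) t) P (θ * t ^ (α - 1))
      ≤ 1 + θ * t ^ (α - 1) * (v ^ 2 * (M * K) / t)
        + (θ * t ^ (α - 1)) ^ 2 * v ^ 2 * M * Real.exp (θ * (v ^ 2 * t ^ α / 4)) * K := by
  set W := truncation (fun ω => v * X ω) t
  set r := θ * t ^ (α - 1)
  set D := r ^ 2 * v ^ 2 * M * Real.exp (θ * (v ^ 2 * t ^ α / 4))
  have hM' : ∀ x : ℝ, x ^ 2 ≤ M * Real.exp (c * |x| ^ α) := fun x =>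
    (hM x).trans (by gcongr; linarith)
  have hvX : MemLp (fun ω => v * X ω) 2 P := (h.memLp_two hM').const_mul v
  have hW : Integrable (fun ω => 1 + r * W ω) P :=
    (integrable_const 1).add (hvX.aestronglyMeasurable.integrable_truncation.const_mul r)
  have hexp := h.integrable_exp.const_mul D
  have hmeanW : ∫ ω, W ω ∂P ≤ v ^ 2 * (M * K) / t := by
    refine (integral_truncation_le_of_integral_eq_zero hvX
      (by rw [integral_const_mul, hmean, mul_zero]) ht).trans ?_
    simp only [mul_pow, integral_const_mul]
    gcongr
    exact h.integral_sq_le hK hM0 hM'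
  calc mgf W P r ≤ ∫ ω, (1 + r * W ω + D * Real.exp (c * |X ω| ^ α)) ∂P :=
        integral_mono_of_nonneg (ae_of_all _ fun _ => (Real.exp_pos _).le) (hW.add hexp)
          (ae_of_all _ (exp_mul_truncation_le hα hα2 hM hθ hθc hv ht))
    _ = 1 + r * ∫ ω, W ω ∂P + D * ∫ ω, Real.exp (c * |X ω| ^ α) ∂P := by
        rw [integral_add hW hexp, integral_const_mul, integral_add (integrable_const 1)
          (hvX.aestronglyMeasurable.integrable_truncation.const_mul r), integral_const_mul]
        simp [W]
    _ ≤ 1 + r * (v ^ 2 * (M * K) / t) + D * K := by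
        gcongr
        exact h.integral_exp_le hK

theorem mgf_truncation_le [IsProbabilityMeasure P] (h : IsSubWeibull α c K X P)
    (hmean : ∫ ω, X ω ∂P = 0) (hα : 0 < α) (hα2 : α ≤ 2) (hc : 0 ≤ c) (hK : 0 ≤ K) (hM0 : 0 ≤ M)
    (hM : ∀ x : ℝ, x ^ 2 ≤ M * Real.exp (c / 2 * |x| ^ α)) (hθ : 0 ≤ θ) (hθc : θ ≤ c / 8)
    (hθM : θ * (M * K) ≤ 1 / 8) (hv : |v| ≤ 1) (ht : 1 ≤ t) :
    mgf (truncation (fun ω => v * X ω) t) P (θ * t ^ (α - 1))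
      ≤ Real.exp (v ^ 2 * (1 + θ * t ^ α / 2)) := by
  have ht0 : 0 < t := by linarith
  have hlinear : t ^ (α - 1) / t ≤ 1 := by
    rw [← Real.rpow_sub_one ht0.ne']
    exact Real.rpow_le_one_of_one_le_of_nonpos ht (by linarith)
  have hquadratic : (t ^ (α - 1)) ^ 2 ≤ t ^ α := by
    rw [← Real.rpow_mul_natCast ht0.le]
    exact Real.rpow_le_rpow_of_exponent_le ht (by push_cast; linarith)
  refine (h.mgf_truncation_le_one_add hmean hα hα2 hc hK hM0 hM hθ hθc hv ht0).trans ?_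
  refine le_trans ?_ (one_add_add_mul_exp_le_exp (sq_nonneg v) (by positivity))
  gcongr 1 + ?_ + ?_
  · calc θ * t ^ (α - 1) * (v ^ 2 * (M * K) / t)
        = v ^ 2 * (θ * (M * K) * (t ^ (α - 1) / t)) := by ring
      _ ≤ v ^ 2 * (1 / 8 * 1) := by gcongr
      _ = v ^ 2 / 8 := by ring
  · calc (θ * t ^ (α - 1)) ^ 2 * v ^ 2 * M * Real.exp (θ * (v ^ 2 * t ^ α / 4)) * K
        = v ^ 2 * (θ * (t ^ (α - 1)) ^ 2) * (θ * (M * K))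
            * Real.exp (v ^ 2 * (θ * t ^ α) / 4) := by ring_nf
      _ ≤ v ^ 2 * (θ * t ^ α) * (1 / 8) * Real.exp (v ^ 2 * (θ * t ^ α) / 4) := by gcongr
      _ = v ^ 2 * (θ * t ^ α) / 8 * Real.exp (v ^ 2 * (θ * t ^ α) / 4) := by ring

theorem measureReal_abs_const_mul_ge_le [IsFiniteMeasure P] (h : IsSubWeibull α c K X P)
    (hα : 0 ≤ α) (hc : 0 ≤ c) (hK : 0 ≤ K) (hM0 : 0 ≤ M)
    (hM : ∀ x : ℝ, x ^ 2 ≤ M * Real.exp (c / 2 * |x| ^ α)) (hv : |v| ≤ 1) (ht : 1 ≤ t) :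
    P.real {ω | t ≤ |v * X ω|} ≤ v ^ 2 * (M * K * Real.exp (-(c / 2 * t ^ α))) := by
  have hle := h.measureReal_le_mul hK (s := {ω | t ≤ |v * X ω|})
    (a := v ^ 2 * (M * Real.exp (-(c / 2 * t ^ α)))) (by positivity)
    fun ω (hω : t ≤ |v * X ω|) => by
      have htX : t ≤ |X ω| := hω.trans (by
        rw [abs_mul]; exact mul_le_of_le_one_left (abs_nonneg _) hv)
      calc (1 : ℝ) ≤ |v * X ω| ^ 2 := one_le_pow₀ (ht.trans hω)
        _ = v ^ 2 * X ω ^ 2 := by rw [sq_abs, mul_pow]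
        _ ≤ v ^ 2 * (M * Real.exp (c / 2 * |X ω| ^ α)) := by gcongr; exact hM _
        _ ≤ v ^ 2 * (M * Real.exp (-(c / 2 * t ^ α) + c * |X ω| ^ α)) := by
            have : c / 2 * t ^ α ≤ c / 2 * |X ω| ^ α := by gcongr
            gcongr
            linarith
        _ = v ^ 2 * (M * Real.exp (-(c / 2 * t ^ α))) * Real.exp (c * |X ω| ^ α) := by
            rw [Real.exp_add]
            ring
  linarith

variable {ι : Type*} [Fintype ι] {X : ι → Ω → ℝ} {v : ι → ℝ}

theorem measureReal_sum_truncation_ge_le (hind : iIndepFun X P)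
    (h : ∀ k, IsSubWeibull α c K (X k) P) (hmean : ∀ k, ∫ ω, X k ω ∂P = 0) (hα : 0 < α)
    (hα2 : α ≤ 2) (hK : 0 ≤ K) (hM0 : 0 ≤ M)
    (hM : ∀ x : ℝ, x ^ 2 ≤ M * Real.exp (c / 2 * |x| ^ α)) (hθ : 0 ≤ θ) (hθc : θ ≤ c / 8)
    (hθM : θ * (M * K) ≤ 1 / 8) (hv : ∀ k, |v k| ≤ 1) (hv2 : ∑ k, v k ^ 2 ≤ 1) (ht : 1 ≤ t) :
    P.real {ω | t ≤ ∑ k, truncation (fun ω => v k * X k ω) t ω}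
      ≤ Real.exp 1 * Real.exp (-(θ / 2 * t ^ α)) := by
  have := hind.isProbabilityMeasure
  have ht0 : 0 < t := by linarith
  have hvind : iIndepFun (fun k ω => v k * X k ω) P :=
    hind.comp (fun k => (v k * ·)) fun k => measurable_const_mul _
  have hWm : ∀ k, AEMeasurable (truncation (fun ω => v k * X k ω) t) P := fun k =>
    ((h k).aemeasurable.const_mul (v k)).aestronglyMeasurable.truncation.aemeasurable
  have hWexp : ∀ k, Integrable
      (fun ω => Real.exp (θ * t ^ (α - 1) * truncation (fun ω => v k * X k ω) t ω)) P := fun k =>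
    integrable_exp_mul_of_mem_Icc (hWm k)
      (ae_of_all _ fun ω => abs_le.1 (abs_truncation_le_bound _ t ω))
  refine (measureReal_sum_ge_le_exp (iIndepFun_truncation hvind t) hWm (by positivity) hWexp
    (fun k => (h k).mgf_truncation_le (hmean k) hα hα2 (by linarith) hK hM0 hM hθ hθc hθM (hv k)
      ht) t).trans ?_
  rw [← Finset.sum_mul, ← Real.exp_add, mul_assoc, ← Real.rpow_add_one ht0.ne', sub_add_cancel]
  gcongr
  have := mul_le_of_le_one_left (by positivity : 0 ≤ 1 + θ * t ^ α / 2) hv2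
  linarith

theorem measureReal_sum_mul_ge_le (hind : iIndepFun X P) (h : ∀ k, IsSubWeibull α c K (X k) P)
    (hmean : ∀ k, ∫ ω, X k ω ∂P = 0) (hα : 0 < α) (hα2 : α ≤ 2) (hK : 0 ≤ K) (hM0 : 0 ≤ M)
    (hM : ∀ x : ℝ, x ^ 2 ≤ M * Real.exp (c / 2 * |x| ^ α)) (hθ : 0 ≤ θ) (hθc : θ ≤ c / 8)
    (hθM : θ * (M * K) ≤ 1 / 8) (hv : ∑ k, v k ^ 2 ≤ 1) (ht : 1 ≤ t) :
    P.real {ω | t ≤ ∑ k, v k * X k ω}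
      ≤ (Real.exp 1 + M * K) * Real.exp (-(θ / 2 * t ^ α)) := by
  have := hind.isProbabilityMeasure
  have hv1 : ∀ k, |v k| ≤ 1 := fun k => by
    rw [← sq_le_one_iff_abs_le_one]
    exact (Finset.single_le_sum (fun i _ => sq_nonneg (v i)) (Finset.mem_univ k)).trans hv
  have hlarge : ∑ k, P.real {ω | t ≤ |v k * X k ω|} ≤ M * K * Real.exp (-(θ / 2 * t ^ α)) :=
    calc ∑ k, P.real {ω | t ≤ |v k * X k ω|}
        ≤ ∑ k, v k ^ 2 * (M * K * Real.exp (-(c / 2 * t ^ α))) := by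
          gcongr with k
          exact (h k).measureReal_abs_const_mul_ge_le hα.le (by linarith) hK hM0 hM (hv1 k) ht
      _ ≤ M * K * Real.exp (-(c / 2 * t ^ α)) := by
          rw [← Finset.sum_mul]
          exact mul_le_of_le_one_left (by positivity) hv
      _ ≤ M * K * Real.exp (-(θ / 2 * t ^ α)) := by
          gcongr
          linarith
  refine (measureReal_sum_ge_le_truncation _ (fun x => x) t t).trans ?_
  rw [add_mul]
  exact add_le_add
    (measureReal_sum_truncation_ge_le hind h hmean hα hα2 hK hM0 hM hθ hθc hθM hv1 hv ht) hlarge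

theorem sum_mul (hind : iIndepFun X P) (h : ∀ k, IsSubWeibull α c K (X k) P)
    (hmean : ∀ k, ∫ ω, X k ω ∂P = 0) (hα : 0 < α) (hα2 : α ≤ 2) (hK : 0 ≤ K) (hM0 : 0 ≤ M)
    (hM : ∀ x : ℝ, x ^ 2 ≤ M * Real.exp (c / 2 * |x| ^ α)) (hθ : 0 < θ) (hθ1 : θ ≤ 1)
    (hθc : θ ≤ c / 8) (hθM : θ * (M * K) ≤ 1 / 8) (hv : ∑ k, v k ^ 2 ≤ 1) :
    IsSubWeibull α (θ / 2 / 2) (1 + 2 * (Real.exp 1 + M * K)) (fun ω => ∑ k, v k * X k ω) P := by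
  have := hind.isProbabilityMeasure
  refine of_measureReal_abs_ge_le hα (by positivity) (by positivity)
    (Finset.aemeasurable_fun_sum _ fun k _ => (h k).aemeasurable.const_mul _) fun t ht => ?_
  rcases le_or_gt 1 t with ht1 | ht1
  · have hsub : {ω | t ≤ |∑ k, v k * X k ω|}
        ⊆ {ω | t ≤ ∑ k, v k * X k ω} ∪ {ω | t ≤ ∑ k, -v k * X k ω} := by
      intro ω (hω : t ≤ |∑ k, v k * X k ω|)
      simpa only [Set.mem_union, Set.mem_ofPred_eq, neg_mul, Finset.sum_neg_distrib]
        using le_abs.1 hω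
    have hupper := measureReal_sum_mul_ge_le hind h hmean hα hα2 hK hM0 hM hθ.le hθc hθM hv ht1
    have hlower := measureReal_sum_mul_ge_le hind h hmean hα hα2 hK hM0 hM hθ.le hθc hθM
      (v := fun k => -v k) (by simpa only [neg_sq] using hv) ht1
    linarith [(measureReal_mono hsub).trans (measureReal_union_le (μ := P) _ _)]
  · have htα : t ^ α ≤ 1 := Real.rpow_le_one ht.le ht1.le hα.le
    have hE : Real.exp (-(1 : ℝ)) ≤ Real.exp (-(θ / 2 * t ^ α)) := by
      gcongr
      nlinarith
    calc P.real _ ≤ 1 := measureReal_le_one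
      _ = Real.exp 1 * Real.exp (-1) := by rw [← Real.exp_add, add_neg_cancel, Real.exp_zero]
      _ ≤ 2 * (Real.exp 1 + M * K) * Real.exp (-(θ / 2 * t ^ α)) := by
          have : 0 ≤ M * K := by positivity
          gcongr
          linarith [Real.exp_pos 1]

end IsSubWeibull

theorem exists_isSubWeibull_sum_mul (hα : 0 < α) (hα2 : α ≤ 2) (hc : 0 < c) (hK : 0 ≤ K) :
    ∃ c' K' : ℝ, 0 < c' ∧ 0 ≤ K' ∧
      ∀ {Ω : Type*} [MeasurableSpace Ω] {P : Measure Ω} {ι : Type*} [Fintype ι] {X : ι → Ω → ℝ},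
      iIndepFun X P → (∀ k, IsSubWeibull α c K (X k) P) → (∀ k, ∫ ω, X k ω ∂P = 0) →
      ∀ v : ι → ℝ, ∑ k, v k ^ 2 ≤ 1 →
        IsSubWeibull α c' K' (fun ω => ∑ k, v k * X k ω) P := by
  obtain ⟨M, hM1, hM⟩ := exists_sq_le_mul_exp_rpow hα (half_pos hc)
  set θ : ℝ := min (c / 8) (1 / (8 * (1 + M * K)))
  have hθ : 0 < θ := lt_min (by positivity) (by positivity)
  have hθ' : θ * (8 * (1 + M * K)) ≤ 1 := (le_div_iff₀ (by positivity)).1 (min_le_right _ _)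
  have hθMK : 0 ≤ θ * (M * K) := by positivity
  refine ⟨θ / 2 / 2, 1 + 2 * (Real.exp 1 + M * K), by positivity, by positivity,
    fun hind hX hmean v hv => IsSubWeibull.sum_mul hind hX hmean hα hα2 hK (by linarith) hM hθ
      (by linarith) (min_le_left _ _) (by linarith) hv⟩

end Hoeffding

section SumOfSquares

variable {Ω : Type*} [MeasurableSpace Ω] {P : Measure Ω} {α β c K M t x y : ℝ}

theorem log_rpow_le_mul (hβ : 0 < β) (hy : 1 ≤ y) : Real.log y ^ β ≤ β ^ β * y := by
  have hlog : Real.log y ≤ β * y ^ β⁻¹ := by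
    simpa [div_inv_eq_mul, mul_comm] using
      Real.log_le_rpow_div (by linarith : 0 ≤ y) (inv_pos.2 hβ)
  calc Real.log y ^ β ≤ (β * y ^ β⁻¹) ^ β := by
        gcongr
        exact Real.log_nonneg hy
    _ = β ^ β * y := by
        rw [Real.mul_rpow hβ.le (by positivity), Real.rpow_inv_rpow (by linarith) hβ.ne']

theorem two_mul_add_log_rpow_le (hβ : 1 ≤ β) (hx : 0 ≤ x) (hy : 1 ≤ y) :
    2 * (x + Real.log y) ^ β ≤ 2 ^ β * (x ^ β + β ^ β * y) :=
  calc 2 * (x + Real.log y) ^ β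
      ≤ 2 * (2 ^ (β - 1) * (x ^ β + Real.log y ^ β)) := by
        gcongr
        exact_mod_cast NNReal.rpow_add_le_mul_rpow_add_rpow ⟨x, hx⟩ ⟨_, Real.log_nonneg hy⟩ hβ
    _ = 2 ^ β * (x ^ β + Real.log y ^ β) := by
        rw [Real.rpow_sub_one two_ne_zero]
        ring
    _ ≤ 2 ^ β * (x ^ β + β ^ β * y) := by
        gcongr
        exact log_rpow_le_mul (by linarith) hy

theorem two_mul_add_log_div_rpow_inv_sq_le (hα : 0 < α) (hα2 : α ≤ 2) (hc : 0 < c) (hx : 0 ≤ x)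
    (hy : 1 ≤ y) :
    2 * (((x + Real.log y) / c) ^ α⁻¹) ^ 2
      ≤ (2 / c) ^ (2 / α) * (x ^ (2 / α) + (2 / α) ^ (2 / α) * y) := by
  have hs : 0 ≤ x + Real.log y := add_nonneg hx (Real.log_nonneg hy)
  calc 2 * (((x + Real.log y) / c) ^ α⁻¹) ^ 2
      = 2 * (x + Real.log y) ^ (2 / α) / c ^ (2 / α) := by
        rw [← Real.rpow_mul_natCast (by positivity), Nat.cast_ofNat, inv_mul_eq_div,
          Real.div_rpow hs hc.le, mul_div_assoc]
    _ ≤ 2 ^ (2 / α) * (x ^ (2 / α) + (2 / α) ^ (2 / α) * y) / c ^ (2 / α) :=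
        div_le_div_of_nonneg_right
          (two_mul_add_log_rpow_le ((one_le_div hα).2 hα2) hx hy) (by positivity)
    _ = (2 / c) ^ (2 / α) * (x ^ (2 / α) + (2 / α) ^ (2 / α) * y) := by
        rw [Real.div_rpow zero_le_two hc.le]
        ring

theorem rpow_sub_two_mul_truncation_sq_le {γ : Type*} (f : γ → ℝ) (hα2 : α ≤ 2) (ht : 0 ≤ t)
    (i : γ) : t ^ (α - 2) * truncation f t i ^ 2 ≤ |f i| ^ α := by
  rcases eq_or_ne (truncation f t i) 0 with h0 | h0
  · rw [h0]
    simp only [ne_eq, OfNat.ofNat_ne_zero, not_false_eq_true, zero_pow, mul_zero]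
    positivity
  · have hpos : 0 < |truncation f t i| := abs_pos.2 h0
    have hself : truncation f t i = f i :=
      (Set.indicator_eq_zero_or_self _ _ _).resolve_left h0
    have hle : |f i| ≤ t := by
      simpa only [hself, abs_of_nonneg ht] using abs_truncation_le_bound f t i
    rw [hself] at hpos ⊢
    calc t ^ (α - 2) * f i ^ 2 ≤ |f i| ^ (α - 2) * f i ^ 2 := by
          gcongr 1
          exact Real.rpow_le_rpow_of_nonpos hpos hle (by linarith)
      _ = |f i| ^ α := by
          rw [← sq_abs, ← Real.rpow_add_natCast hpos.ne']
          norm_num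

namespace IsSubWeibull

theorem mgf_truncation_sq_le [IsProbabilityMeasure P] {X : Ω → ℝ} (h : IsSubWeibull α c K X P)
    (hα2 : α ≤ 2) (hc : 0 ≤ c) (hK : 0 ≤ K) (hM0 : 0 ≤ M)
    (hM : ∀ x : ℝ, x ^ 2 ≤ M * Real.exp (c / 2 * |x| ^ α)) (ht : 0 ≤ t) :
    mgf (fun ω => truncation X t ω ^ 2) P (c / 2 * t ^ (α - 2))
      ≤ Real.exp (c / 2 * t ^ (α - 2) * (M * K)) := by
  set r := c / 2 * t ^ (α - 2)
  have hle : ∀ ω, Real.exp (r * truncation X t ω ^ 2)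
      ≤ 1 + r * M * Real.exp (c * |X ω| ^ α) := fun ω => by
    have hexponent : r * truncation X t ω ^ 2 ≤ c / 2 * |X ω| ^ α := by
      rw [mul_assoc]
      gcongr
      exact rpow_sub_two_mul_truncation_sq_le X hα2 ht ω
    have hsq : truncation X t ω ^ 2 ≤ M * Real.exp (c / 2 * |X ω| ^ α) :=
      (sq_le_sq.2 (abs_truncation_le_abs_self _ _ _)).trans (hM _)
    calc Real.exp (r * truncation X t ω ^ 2)
        ≤ 1 + r * truncation X t ω ^ 2 * Real.exp (r * truncation X t ω ^ 2) :=
          exp_le_one_add_mul_exp _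
      _ ≤ 1 + r * (M * Real.exp (c / 2 * |X ω| ^ α)) * Real.exp (c / 2 * |X ω| ^ α) := by gcongr
      _ = 1 + r * M * Real.exp (c / 2 * |X ω| ^ α + c / 2 * |X ω| ^ α) := by
          rw [Real.exp_add]
          ring
      _ = 1 + r * M * Real.exp (c * |X ω| ^ α) := by ring_nf
  have hexp := h.integrable_exp.const_mul (r * M)
  calc mgf (fun ω => truncation X t ω ^ 2) P r
      ≤ ∫ ω, (1 + r * M * Real.exp (c * |X ω| ^ α)) ∂P :=
        integral_mono_of_nonneg (ae_of_all _ fun _ => (Real.exp_pos _).le)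
          ((integrable_const 1).add hexp) (ae_of_all _ hle)
    _ = r * M * ∫ ω, Real.exp (c * |X ω| ^ α) ∂P + 1 := by
        rw [integral_add (integrable_const 1) hexp, integral_const_mul, integral_const,
          probReal_univ, one_smul, add_comm]
    _ ≤ r * M * K + 1 := by
        gcongr
        exact h.integral_exp_le hK
    _ ≤ Real.exp (r * (M * K)) := by
        rw [mul_assoc]
        exact Real.add_one_le_exp _

variable {ι : Type*} [Fintype ι] {X : ι → Ω → ℝ}

theorem measureReal_sum_truncation_sq_ge_le (hind : iIndepFun X P)
    (h : ∀ k, IsSubWeibull α c K (X k) P) (hα2 : α ≤ 2) (hc : 0 ≤ c) (hK : 0 ≤ K) (hM0 : 0 ≤ M)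
    (hM : ∀ x : ℝ, x ^ 2 ≤ M * Real.exp (c / 2 * |x| ^ α)) (ht : 0 < t) :
    P.real {ω | M * K * Fintype.card ι + 2 * t ^ 2 ≤ ∑ k, truncation (X k) t ω ^ 2}
      ≤ Real.exp (-(c * t ^ α)) := by
  have := hind.isProbabilityMeasure
  have htind : iIndepFun (fun k ω => truncation (X k) t ω ^ 2) P :=
    (iIndepFun_truncation hind t).comp (fun _ x => x ^ 2) fun _ => by fun_prop
  have hWm : ∀ k, AEMeasurable (fun ω => truncation (X k) t ω ^ 2) P := fun k =>
    (h k).aemeasurable.aestronglyMeasurable.truncation.aemeasurable.pow_const 2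
  have hWexp : ∀ k, Integrable
      (fun ω => Real.exp (c / 2 * t ^ (α - 2) * truncation (X k) t ω ^ 2)) P := fun k =>
    integrable_exp_mul_of_mem_Icc (a := 0) (b := |t| ^ 2) (hWm k)
      (ae_of_all _ fun ω => ⟨sq_nonneg _, by
        rw [← sq_abs (truncation (X k) t ω)]
        exact pow_le_pow_left₀ (abs_nonneg _) (abs_truncation_le_bound _ t ω) 2⟩)
  refine (measureReal_sum_ge_le_exp htind hWm (by positivity) hWexp
    (fun k => (h k).mgf_truncation_sq_le hα2 hc hK hM0 hM ht.le) _).trans_eq ?_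
  have hpow : t ^ (α - 2) * t ^ 2 = t ^ α := by
    rw [← Real.rpow_add_natCast ht.ne']
    norm_num
  rw [Finset.sum_const, Finset.card_univ, nsmul_eq_mul, ← hpow]
  ring_nf

theorem measureReal_sum_sq_ge_le (hind : iIndepFun X P)
    (h : ∀ k, IsSubWeibull α c K (X k) P) (hα : 0 ≤ α) (hα2 : α ≤ 2) (hc : 0 ≤ c) (hK : 0 ≤ K)
    (hM0 : 0 ≤ M) (hM : ∀ x : ℝ, x ^ 2 ≤ M * Real.exp (c / 2 * |x| ^ α)) (ht : 0 < t) :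
    P.real {ω | M * K * Fintype.card ι + 2 * t ^ 2 ≤ ∑ k, X k ω ^ 2}
      ≤ (1 + K * Fintype.card ι) * Real.exp (-(c * t ^ α)) := by
  have := hind.isProbabilityMeasure
  have hlarge : ∑ k, P.real {ω | t ≤ |X k ω|}
      ≤ K * Fintype.card ι * Real.exp (-(c * t ^ α)) := by
    refine (Finset.sum_le_card_nsmul _ _ _ fun k _ =>
      (h k).measureReal_abs_ge_le hα hc hK ht.le).trans_eq ?_
    rw [Finset.card_univ, nsmul_eq_mul]
    ring
  refine (measureReal_sum_ge_le_truncation X (fun x => x ^ 2) _ t).trans ?_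
  rw [add_mul, one_mul]
  exact add_le_add (measureReal_sum_truncation_sq_ge_le hind h hα2 hc hK hM0 hM ht) hlarge

end IsSubWeibull

theorem exists_measureReal_sum_sq_ge_le (hα : 0 < α) (hα2 : α ≤ 2) (hc : 0 < c) (hK : 0 ≤ K) :
    ∃ a b : ℝ, 0 < a ∧ 0 < b ∧
      ∀ {Ω : Type*} [MeasurableSpace Ω] {P : Measure Ω} {ι : Type*} [Fintype ι] [Nonempty ι]
        {X : ι → Ω → ℝ}, iIndepFun X P → (∀ k, IsSubWeibull α c K (X k) P) → ∀ L : ℝ, 0 < L →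
        P.real {ω | a * Fintype.card ι + b * L ^ (2 / α) ≤ ∑ k, X k ω ^ 2} ≤ Real.exp (-L) := by
  obtain ⟨M, hM1, hM⟩ := exists_sq_le_mul_exp_rpow hα (half_pos hc)
  refine ⟨M * K + (2 / c) ^ (2 / α) * ((2 / α) ^ (2 / α) * (1 + K)), (2 / c) ^ (2 / α),
    by positivity, by positivity, fun {Ω _ P ι _ _ X} hind hX L hL => ?_⟩
  have := hind.isProbabilityMeasure
  set p : ℝ := (Fintype.card ι : ℝ)
  have hp : 1 ≤ p := Nat.one_le_cast.2 Fintype.card_pos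
  have hy : 1 ≤ (1 + K) * p := by nlinarith
  have hs : 0 < L + Real.log ((1 + K) * p) := by linarith [Real.log_nonneg hy]
  -- The level at which the failure probability `(1 + K p) exp (-c t ^ α)` drops to `exp (-L)`.
  set t := ((L + Real.log ((1 + K) * p)) / c) ^ α⁻¹ with ht
  have htsq := two_mul_add_log_div_rpow_inv_sq_le hα hα2 hc hL.le hy
  have htα : c * t ^ α = L + Real.log ((1 + K) * p) := by
    rw [ht, Real.rpow_inv_rpow (by positivity) hα.ne', mul_div_cancel₀ _ hc.ne']
  calc P.real {ω | (M * K + (2 / c) ^ (2 / α) * ((2 / α) ^ (2 / α) * (1 + K))) * p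
        + (2 / c) ^ (2 / α) * L ^ (2 / α) ≤ ∑ k, X k ω ^ 2}
      ≤ P.real {ω | M * K * p + 2 * t ^ 2 ≤ ∑ k, X k ω ^ 2} := by
        refine measureReal_mono fun ω hω => ?_
        rw [Set.mem_ofPred_eq] at hω ⊢
        linarith
    _ ≤ (1 + K * p) * Real.exp (-(c * t ^ α)) :=
        IsSubWeibull.measureReal_sum_sq_ge_le hind hX hα.le hα2 hc.le hK (by linarith) hM
          (by positivity)
    _ = (1 + K * p) / ((1 + K) * p) * Real.exp (-L) := by
        rw [htα, neg_add, Real.exp_add, Real.exp_neg (Real.log _), Real.exp_log (by linarith)]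
        ring
    _ ≤ Real.exp (-L) := by
        refine mul_le_of_le_one_left (Real.exp_pos _).le ((div_le_one (by linarith)).2 ?_)
        linarith

end SumOfSquares

section RandomMatrix

variable {Ω : Type*} [MeasurableSpace Ω] {P : Measure Ω}

theorem iIndepFun_curry {ι κ E : Type*} [Countable ι] [Countable κ] [MeasurableSpace E]
    {X : ι → κ → Ω → E} (hX : ∀ i j, AEMeasurable (X i j) P)
    (h : iIndepFun (fun q : ι × κ => X q.1 q.2) P) : iIndepFun (fun i ω j => X i j ω) P := by
  have := h.isProbabilityMeasure
  have hprob : ∀ i j, IsProbabilityMeasure (P.map (X i j)) := fun i j =>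
    Measure.isProbabilityMeasure_map (hX i j)
  have hpair : ∀ q : ι × κ, AEMeasurable (X q.1 q.2) P := fun q => hX q.1 q.2
  have hrow : ∀ i, P.map (fun ω j => X i j ω) = Measure.infinitePi fun j => P.map (X i j) :=
    fun i => (h.precomp (Prod.mk_right_injective i)).map_fun_eq_infinitePi_map₀' (hX i)
  rw [iIndepFun_iff_map_fun_eq_infinitePi_map₀' fun i => aemeasurable_pi_iff.2 (hX i)]
  simp_rw [hrow]
  rw [← Measure.infinitePi_map_curry fun i j => P.map (X i j),
    ← h.map_fun_eq_infinitePi_map₀' hpair,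
    AEMeasurable.map_map_of_aemeasurable (by fun_prop) (aemeasurable_pi_iff.2 hpair)]
  rfl

theorem exists_measureReal_sum_sum_mul_sq_ge_le {α c K : ℝ} (hα : 0 < α) (hα2 : α ≤ 2)
    (hc : 0 < c) (hK : 0 ≤ K) :
    ∃ a b : ℝ, 0 < a ∧ 0 < b ∧
      ∀ {Ω : Type*} [MeasurableSpace Ω] {P : Measure Ω} {ι κ : Type*} [Fintype ι] [Fintype κ]
        [Nonempty κ] {X : ι → κ → Ω → ℝ}, iIndepFun (fun q : ι × κ => X q.1 q.2) P →
        (∀ k j, IsSubWeibull α c K (X k j) P) → (∀ k j, ∫ ω, X k j ω ∂P = 0) →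
      ∀ v : ι → ℝ, ∑ k, v k ^ 2 ≤ 1 → ∀ L, 0 < L →
        P.real {ω | a * Fintype.card κ + b * L ^ (2 / α) ≤ ∑ j, (∑ k, v k * X k j ω) ^ 2} ≤
          Real.exp (-L) := by
  obtain ⟨c', K', hc', hK', hsum⟩ := exists_isSubWeibull_sum_mul hα hα2 hc hK
  obtain ⟨a, b, ha, hb, hsq⟩ := exists_measureReal_sum_sq_ge_le hα hα2 hc' hK'
  refine ⟨a, b, ha, hb, fun {_ _ _ ι κ _ _ _ X} hind hX hmean v hv => hsq ?_ fun j => ?_⟩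
  · have hcol : iIndepFun (fun j ω k => X k j ω) _ :=
      iIndepFun_curry (fun j k => (hX k j).aemeasurable) (hind.precomp Prod.swap_injective)
    exact hcol.comp (fun _ w => ∑ k, v k * w k) fun _ => by fun_prop
  · exact hsum (hind.precomp (Prod.mk_left_injective j)) (hX · j) (hmean · j) v hv

end RandomMatrix

section OperatorNorm

theorem card_le_of_isSeparated_of_subset_closedBall {E : Type*} [NormedAddCommGroup E]
    [NormedSpace ℝ E] [FiniteDimensional ℝ E] {s : Finset E}
    (hs : (s : Set E) ⊆ Metric.closedBall 0 1)
    (hsep : Metric.IsSeparated (1 / 2 : NNReal) (s : Set E)) :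
    s.card ≤ 5 ^ Module.finrank ℝ E := by
  classical
  have hinj : Function.Injective fun x : E => (2 : ℝ) • x := smul_right_injective E two_ne_zero
  rw [← Finset.card_image_of_injective s hinj]
  refine Besicovitch.card_le_of_separated _ ?_ ?_
  · rintro _ hx
    obtain ⟨v, hv, rfl⟩ := Finset.mem_image.1 hx
    rw [norm_smul, Real.norm_two]
    linarith [mem_closedBall_zero_iff.1 (hs hv)]
  · rintro _ hx _ hy hxy
    obtain ⟨v, hv, rfl⟩ := Finset.mem_image.1 hx
    obtain ⟨w, hw, rfl⟩ := Finset.mem_image.1 hy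
    have hdist : 1 / 2 < dist v w := by
      have hlt : ((1 / 2 : NNReal) : ℝ≥0∞) < edist v w := hsep hv hw (ne_of_apply_ne _ hxy)
      rw [edist_nndist, ENNReal.coe_lt_coe] at hlt
      exact_mod_cast hlt
    rw [← smul_sub, norm_smul, Real.norm_two, ← dist_eq_norm]
    linarith

theorem packingNumber_closedBall_le (E : Type*) [NormedAddCommGroup E] [NormedSpace ℝ E]
    [FiniteDimensional ℝ E] :
    Metric.packingNumber (1 / 2) (Metric.closedBall (0 : E) 1) ≤
      (5 ^ Module.finrank ℝ E : ℕ) := by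
  refine iSup_le fun C => iSup₂_le fun hC hsep => ?_
  by_contra! hlt
  obtain ⟨t, htC, ht⟩ := Set.exists_subset_encard_eq (Order.add_one_le_of_lt hlt)
  lift t to Finset E using Set.finite_of_encard_eq_coe ht
  have hcard := card_le_of_isSeparated_of_subset_closedBall (htC.trans hC)
    (hsep.subset htC)
  rw [Set.encard_coe_eq_coe_finsetCard] at ht
  have : t.card = 5 ^ Module.finrank ℝ E + 1 := by exact_mod_cast ht
  omega

theorem exists_finset_isCover_closedBall (E : Type*) [NormedAddCommGroup E] [NormedSpace ℝ E]
    [FiniteDimensional ℝ E] :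
    ∃ N : Finset E, N.card ≤ 5 ^ Module.finrank ℝ E ∧ (N : Set E) ⊆ Metric.closedBall 0 1 ∧
      Metric.IsCover (1 / 2) (Metric.closedBall 0 1) (N : Set E) := by
  have hle := packingNumber_closedBall_le E
  have htop : Metric.packingNumber (1 / 2) (Metric.closedBall (0 : E) 1) ≠ ⊤ :=
    ne_top_of_le_ne_top (ENat.natCast_ne_top _) hle
  have hcard := (Metric.encard_maximalSeparatedSet htop).trans_le hle
  obtain ⟨N, hN⟩ := (Set.finite_of_encard_le_coe hcard).exists_finset_coe
  rw [← hN, Set.encard_coe_eq_coe_finsetCard, Nat.cast_le] at hcard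
  refine ⟨N, hcard, ?_, ?_⟩ <;> rw [hN]
  exacts [Metric.maximalSeparatedSet_subset, Metric.isCover_maximalSeparatedSet htop]

variable {E F : Type*} [NormedAddCommGroup E] [NormedAddCommGroup F]

theorem opNorm_le_two_mul_of_isCover [NormedSpace ℝ E] [NormedSpace ℝ F] (f : E →L[ℝ] F)
    {N : Set E} (hN : Metric.IsCover (1 / 2) (Metric.closedBall 0 1) N) {T : ℝ} (hT : 0 ≤ T)
    (hf : ∀ v ∈ N, ‖f v‖ ≤ T) : ‖f‖ ≤ 2 * T := by
  have hle : ‖f‖ ≤ T + ‖f‖ * (1 / 2) := by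
    refine f.opNorm_le_of_unit_norm (by positivity) fun x hx => ?_
    obtain ⟨v, hv, hxv⟩ := Set.mem_iUnion₂.1
      (Metric.isCover_iff_subset_iUnion_closedBall.1 hN (mem_closedBall_zero_iff.2 hx.le))
    have hdist : ‖x - v‖ ≤ 1 / 2 := by simpa [dist_eq_norm] using hxv
    calc ‖f x‖ = ‖f v + f (x - v)‖ := by rw [← map_add, add_sub_cancel]
      _ ≤ ‖f v‖ + ‖f (x - v)‖ := norm_add_le _ _
      _ ≤ T + ‖f‖ * (1 / 2) := add_le_add (hf v hv) (f.le_of_opNorm_le_of_le le_rfl hdist)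
  linarith

theorem measureReal_lt_opNorm_le [NormedSpace ℝ E] [FiniteDimensional ℝ E] [NormedSpace ℝ F]
    {Ω : Type*} [MeasurableSpace Ω] {P : Measure Ω} [IsFiniteMeasure P] {A : Ω → E →L[ℝ] F}
    {T ε : ℝ} (hT : 0 ≤ T) (h : ∀ v, ‖v‖ ≤ 1 → P.real {ω | T ≤ ‖A ω v‖} ≤ ε) :
    P.real {ω | 2 * T < ‖A ω‖} ≤ 5 ^ Module.finrank ℝ E * ε := by
  obtain ⟨N, hcard, hN, hcover⟩ := exists_finset_isCover_closedBall E
  have hε : 0 ≤ ε := measureReal_nonneg.trans (h 0 (by simp))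
  have hsub : {ω | 2 * T < ‖A ω‖} ⊆ ⋃ v ∈ N, {ω | T ≤ ‖A ω v‖} := by
    intro ω hω
    by_contra hfar
    simp only [Set.mem_iUnion, Set.mem_ofPred_eq, exists_prop, not_exists, not_and,
      not_le] at hfar
    exact not_le.2 hω (opNorm_le_two_mul_of_isCover _ hcover hT fun v hv => (hfar v hv).le)
  calc P.real {ω | 2 * T < ‖A ω‖}
      ≤ ∑ v ∈ N, P.real {ω | T ≤ ‖A ω v‖} :=
        (measureReal_mono hsub (measure_ne_top _ _)).trans (measureReal_biUnion_finset_le _ _)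
    _ ≤ ∑ _v ∈ N, ε :=
        Finset.sum_le_sum fun v hv => h v (mem_closedBall_zero_iff.1 (hN hv))
    _ = N.card * ε := by rw [Finset.sum_const, nsmul_eq_mul]
    _ ≤ 5 ^ Module.finrank ℝ E * ε := by
        gcongr
        exact_mod_cast hcard

theorem singularValues_le_of_norm_le [InnerProductSpace ℝ E] [FiniteDimensional ℝ E]
    [InnerProductSpace ℝ F] [FiniteDimensional ℝ F] (f : E →ₗ[ℝ] F) {c : ℝ} (hc : 0 ≤ c)
    (hf : ∀ x, ‖f x‖ ≤ c * ‖x‖) (i : ℕ) : f.singularValues i ≤ c := by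
  rcases le_or_gt (Module.finrank ℝ E) i with hi | hi
  · rwa [f.singularValues_of_finrank_le hi]
  obtain ⟨x, hx⟩ := (f.hasEigenvalue_adjoint_comp_self_sq_singularValues hi).exists_hasEigenvector
  have hnorm : ‖f x‖ ^ 2 = (f.singularValues i * ‖x‖) ^ 2 :=
    calc ‖f x‖ ^ 2 = inner ℝ ((f.adjoint ∘ₗ f) x) x := by
          rw [LinearMap.comp_apply, LinearMap.adjoint_inner_left, real_inner_self_eq_norm_sq]
      _ = (f.singularValues i * ‖x‖) ^ 2 := by
          rw [hx.apply_eq_smul, real_inner_smul_left, real_inner_self_eq_norm_sq, mul_pow]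
          simp
  refine le_of_mul_le_mul_right ?_ (norm_pos_iff.2 hx.2)
  exact (le_of_sq_le_sq hnorm.ge (norm_nonneg _)).trans (hf x)

end OperatorNorm

section Law

variable {Ω : Type*} [MeasurableSpace Ω] {P : Measure Ω}

theorem IsSubWeibull.comp_hasLaw {E : Type*} [MeasurableSpace E] {ρ : Measure E} {α c K : ℝ}
    {f : E → ℝ} {Y : Ω → E} (hf : IsSubWeibull α c K f ρ) (hY : HasLaw Y ρ P) :
    IsSubWeibull α c K (fun ω => f (Y ω)) P where
  aemeasurable := (hY.map_eq ▸ hf.aemeasurable).comp_aemeasurable hY.aemeasurable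
  lintegral_exp_le := by
    have hfm := hf.aemeasurable
    refine le_of_eq_of_le ?_ hf.lintegral_exp_le
    exact hY.lintegral_comp (X := Y) (f := fun x => ENNReal.ofReal (Real.exp (c * |f x| ^ α)))
      (by fun_prop)

theorem iIndepFun_eval_of_hasLaw_pi {ι κ E : Type*} [Fintype κ] [MeasurableSpace E]
    {ν : ι → κ → Measure E} [∀ k j, IsProbabilityMeasure (ν k j)] {Y : ι → Ω → κ → E}
    (hmeas : ∀ k, Measurable (Y k)) (hY : ∀ k, HasLaw (Y k) (Measure.pi (ν k)) P)
    (hind : iIndepFun Y P) : iIndepFun (fun (q : ι × κ) ω => Y q.1 ω q.2) P := by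
  have := hind.isProbabilityMeasure
  refine iIndepFun_uncurry' (X := fun k j ω => Y k ω j) (by fun_prop) hind fun k => ?_
  rw [iIndepFun_iff_map_fun_eq_pi_map (by fun_prop)]
  refine (hY k).map_eq.trans ?_
  congr 1 with j : 1
  exact ((measurePreserving_eval (ν k) j).hasLaw.comp (hY k)).map_eq.symm

end Law

section CleanDistribution

instance : IsProbabilityMeasure uniformLabel := by
  unfold uniformLabel
  infer_instance

theorem measurable_labelVal : Measurable labelVal :=
  measurable_of_countable _

theorem abs_labelVal (y : ℤˣ) : |labelVal y| = 1 := by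
  rcases Int.units_eq_one_or y with rfl | rfl <;> simp [labelVal]

theorem isSubWeibull_of_orliczNorm_lt {Ω : Type*} [MeasurableSpace Ω] {P : Measure Ω} {α s : ℝ}
    {X : Ω → ℝ} (hα : 0 ≤ α) (hX : AEMeasurable X P)
    (h : orliczNorm α X P < ENNReal.ofReal s) : IsSubWeibull α (s ^ α)⁻¹ 2 X P where
  aemeasurable := hX
  lintegral_exp_le := by
    obtain ⟨_, ⟨t, ⟨ht0, ht⟩, rfl⟩, hts⟩ := sInf_lt_iff.1 h
    have hts : t ≤ s := (ENNReal.ofReal_lt_ofReal_iff_of_nonneg ht0.le).1 hts |>.le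
    rw [ENNReal.ofReal_ofNat]
    refine (lintegral_mono fun ω => ?_).trans ht
    rw [inv_mul_eq_div]
    gcongr

variable {n p : ℕ} {U : Matrix (Fin p) (Fin p) ℝ}

theorem norm_toLp_mulVec_of_mem_orthogonalGroup (hU : U ∈ Matrix.orthogonalGroup (Fin p) ℝ)
    (w : Fin p → ℝ) :
    ‖(WithLp.toLp 2 (U.mulVec w) : EuclideanSpace ℝ (Fin p))‖ =
      ‖(WithLp.toLp 2 w : EuclideanSpace ℝ (Fin p))‖ := by
  have hsq : ∀ u : Fin p → ℝ, ‖(WithLp.toLp 2 u : EuclideanSpace ℝ (Fin p))‖ ^ 2 = u ⬝ᵥ u := by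
    intro u
    rw [EuclideanSpace.norm_sq_eq]
    simp [dotProduct, sq]
  rw [← sq_eq_sq₀ (norm_nonneg _) (norm_nonneg _), hsq, hsq, Matrix.dotProduct_mulVec,
    Matrix.vecMul_mulVec, (Matrix.mem_orthogonalGroup_iff' (Fin p) ℝ).1 hU, Matrix.vecMul_one]

theorem abs_sum_mul_le_sqrt_of_abs_le_one {v : EuclideanSpace ℝ (Fin n)} (hv : ‖v‖ ≤ 1)
    {w : Fin n → ℝ} (hw : ∀ k, |w k| ≤ 1) : |∑ k, v k * w k| ≤ Real.sqrt n := by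
  refine Real.abs_le_sqrt ?_
  calc (∑ k, v k * w k) ^ 2 ≤ (∑ k, v k ^ 2) * ∑ k, w k ^ 2 :=
        Finset.sum_mul_sq_le_sq_mul_sq _ _ _
    _ ≤ 1 * ∑ _k : Fin n, 1 := by
        rw [← EuclideanSpace.real_norm_sq_eq]
        gcongr with k
        · exact pow_le_one₀ (norm_nonneg _) hv
        · exact (sq_le_one_iff_abs_le_one _).2 (hw k)
    _ = n := by simp

/-- The input `U q + ỹ μ` generated by the cluster noise `q` and the label `ỹ`, where `z = (q, ỹ)`.
Its law under `P_clust × Uniform {±1}` is the first marginal of `cleanLaw`. -/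
def cleanInput (U : Matrix (Fin p) (Fin p) ℝ) (μ : EuclideanSpace ℝ (Fin p))
    (z : (Fin p → ℝ) × ℤˣ) : EuclideanSpace ℝ (Fin p) :=
  WithLp.toLp 2 (U.mulVec z.1) + labelVal z.2 • μ

theorem measurable_cleanInput (U : Matrix (Fin p) (Fin p) ℝ) (μ : EuclideanSpace ℝ (Fin p)) :
    Measurable (cleanInput U μ) := by
  have hU : Measurable fun q : Fin p → ℝ => U.mulVec q :=
    (Continuous.matrix_mulVec continuous_const continuous_id).measurable
  have := measurable_labelVal
  unfold cleanInput
  fun_prop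

theorem cleanLaw_map_fst (ν : Fin p → Measure ℝ) (U : Matrix (Fin p) (Fin p) ℝ)
    (μ : EuclideanSpace ℝ (Fin p)) :
    (cleanLaw ν U μ).map Prod.fst = ((Measure.pi ν).prod uniformLabel).map (cleanInput U μ) := by
  rw [cleanLaw, Measure.map_map measurable_fst]
  · rfl
  · exact (measurable_cleanInput U μ).prodMk measurable_snd

theorem norm_sum_smul_cleanInput_le (hU : U ∈ Matrix.orthogonalGroup (Fin p) ℝ)
    (μ : EuclideanSpace ℝ (Fin p)) {v : EuclideanSpace ℝ (Fin n)} (hv : ‖v‖ ≤ 1)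
    (z : Fin n → (Fin p → ℝ) × ℤˣ) :
    ‖∑ k, v k • cleanInput U μ (z k)‖ ≤
      Real.sqrt (∑ j, (∑ k, v k * (z k).1 j) ^ 2) + Real.sqrt n * ‖μ‖ := by
  have hsplit : ∑ k, v k • cleanInput U μ (z k) =
      WithLp.toLp 2 (U.mulVec fun j => ∑ k, v k * (z k).1 j) +
        (∑ k, v k * labelVal (z k).2) • μ := by
    have hnoise : (fun j => ∑ k, v k * (z k).1 j) = ∑ k, v k • (z k).1 := by
      ext j
      simp
    rw [hnoise, Matrix.mulVec_sum, WithLp.toLp_sum]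
    simp [cleanInput, Matrix.mulVec_smul, smul_smul, Finset.sum_add_distrib, Finset.sum_smul]
  rw [hsplit]
  refine (norm_add_le _ _).trans (add_le_add ?_ ?_)
  · rw [norm_toLp_mulVec_of_mem_orthogonalGroup hU, EuclideanSpace.norm_eq]
    simp
  · rw [norm_smul]
    gcongr
    exact abs_sum_mul_le_sqrt_of_abs_le_one hv fun k => (abs_labelVal _).le

theorem hasLaw_pi_cleanInput {ν : Fin p → Measure ℝ} [∀ j, IsProbabilityMeasure (ν j)]
    {μ : EuclideanSpace ℝ (Fin p)} {Ω : Type*} [MeasurableSpace Ω] {Pr : Measure Ω}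
    {x : Fin n → Ω → EuclideanSpace ℝ (Fin p)}
    (hx : ∀ k, HasLaw (x k) ((cleanLaw ν U μ).map Prod.fst) Pr) (hind : iIndepFun x Pr) :
    HasLaw (fun ω k => x k ω) ((Measure.pi fun _ => (Measure.pi ν).prod uniformLabel).map
      fun z k => cleanInput U μ (z k)) Pr := by
  have hmeas := measurable_cleanInput U μ
  have : ∀ _ : Fin n, IsProbabilityMeasure
      (((Measure.pi ν).prod uniformLabel).map (cleanInput U μ)) :=
    fun _ => Measure.isProbabilityMeasure_map hmeas.aemeasurable
  rw [Measure.pi_map_pi fun _ => hmeas.aemeasurable]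
  simp_rw [cleanLaw_map_fst] at hx
  exact hind.hasLaw_pi hx

theorem exists_measureReal_sum_noise_sq_ge_le {α : ℝ} (hα : 0 < α) (hα2 : α ≤ 2) :
    ∃ a b : ℝ, 0 < a ∧ 0 < b ∧ ∀ {n p : ℕ}, 0 < p → ∀ {ν : Fin p → Measure ℝ}
      [∀ j, IsProbabilityMeasure (ν j)], (∀ j, ∫ x, x ∂(ν j) = 0) →
      (∀ j, orliczNorm α (fun x : ℝ => x) (ν j) ≤ 1) →
      ∀ {F : Type*} [MeasurableSpace F] {ρ : Measure F} [IsProbabilityMeasure ρ],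
      ∀ v : EuclideanSpace ℝ (Fin n), ‖v‖ ≤ 1 → ∀ L, 0 < L →
        (Measure.pi fun _ : Fin n => (Measure.pi ν).prod ρ).real
          {z | a * p + b * L ^ (2 / α) ≤ ∑ j, (∑ k, v k * (z k).1 j) ^ 2} ≤ Real.exp (-L) := by
  obtain ⟨a, b, ha, hb, hab⟩ := exists_measureReal_sum_sum_mul_sq_ge_le
    (c := ((2 : ℝ) ^ α)⁻¹) (K := 2) hα hα2 (by positivity) zero_le_two
  refine ⟨a, b, ha, hb, fun {n p} hp ν _ hmean hnorm F _ ρ _ v hv L hL => ?_⟩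
  have : Nonempty (Fin p) := ⟨⟨0, hp⟩⟩
  set Q : Measure (Fin n → (Fin p → ℝ) × F) := Measure.pi fun _ => (Measure.pi ν).prod ρ
  have hrow : ∀ k, MeasurePreserving (fun z : Fin n → (Fin p → ℝ) × F => (z k).1) Q
      (Measure.pi ν) := fun k =>
    measurePreserving_fst.comp (measurePreserving_eval _ k)
  have hentry : ∀ k j, HasLaw (fun z : Fin n → (Fin p → ℝ) × F => (z k).1 j) (ν j) Q :=
    fun k j => ((measurePreserving_eval ν j).comp (hrow k)).hasLaw
  have hind : iIndepFun
      (fun (q : Fin n × Fin p) (z : Fin n → (Fin p → ℝ) × F) => (z q.1).1 q.2) Q :=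
    iIndepFun_eval_of_hasLaw_pi (fun k => (hrow k).measurable) (fun k => (hrow k).hasLaw)
      (iIndepFun_pi (X := fun _ => Prod.fst) fun _ => measurable_fst.aemeasurable)
  have hone : ∀ j, IsSubWeibull α ((2 : ℝ) ^ α)⁻¹ 2 (fun x => x) (ν j) := fun j =>
    isSubWeibull_of_orliczNorm_lt hα.le aemeasurable_id' ((hnorm j).trans_lt (by simp))
  simpa using hab hind (fun k j => (hone j).comp_hasLaw (hentry k j))
    (fun k j => ((hentry k j).integral_eq).trans (hmean j)) v
    (by rw [← EuclideanSpace.real_norm_sq_eq]; exact pow_le_one₀ (norm_nonneg _) hv) L hL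

theorem exists_measureReal_norm_sum_smul_ge_le {α : ℝ} (hα : 0 < α) (hα2 : α ≤ 2) :
    ∃ a b : ℝ, 0 < a ∧ 0 < b ∧ ∀ {n p : ℕ}, 0 < p → ∀ {ν : Fin p → Measure ℝ}
      [∀ j, IsProbabilityMeasure (ν j)], (∀ j, ∫ x, x ∂(ν j) = 0) →
      (∀ j, orliczNorm α (fun x : ℝ => x) (ν j) ≤ 1) →
      ∀ {U : Matrix (Fin p) (Fin p) ℝ}, U ∈ Matrix.orthogonalGroup (Fin p) ℝ →
      ∀ {μ : EuclideanSpace ℝ (Fin p)} {Ω : Type*} [MeasurableSpace Ω] {Pr : Measure Ω}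
        {x : Fin n → Ω → EuclideanSpace ℝ (Fin p)},
      (∀ k, HasLaw (x k) ((cleanLaw ν U μ).map Prod.fst) Pr) → iIndepFun x Pr →
      ∀ v : EuclideanSpace ℝ (Fin n), ‖v‖ ≤ 1 → ∀ L, 0 < L →
        Pr.real {ω | Real.sqrt (a * p + b * L ^ (2 / α)) + Real.sqrt n * ‖μ‖ ≤
          ‖∑ k, v k • x k ω‖} ≤ Real.exp (-L) := by
  obtain ⟨a, b, ha, hb, hab⟩ := exists_measureReal_sum_noise_sq_ge_le hα hα2
  refine ⟨a, b, ha, hb, fun {n p} hp ν _ hmean hnorm U hU μ Ω _ Pr x hx hind v hv L hL => ?_⟩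
  set t := a * p + b * L ^ (2 / α)
  set T := Real.sqrt t + Real.sqrt n * ‖μ‖
  have hmeas : MeasurableSet {y : Fin n → EuclideanSpace ℝ (Fin p) | T ≤ ‖∑ k, v k • y k‖} :=
    measurableSet_le measurable_const (by fun_prop)
  have hclean := measurable_cleanInput U μ
  calc Pr.real {ω | T ≤ ‖∑ k, v k • x k ω‖}
      = (Measure.pi fun _ => (Measure.pi ν).prod uniformLabel).real
          {z | T ≤ ‖∑ k, v k • cleanInput U μ (z k)‖} := by
        rw [(hasLaw_pi_cleanInput hx hind).measureReal_eq hmeas,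
          map_measureReal_apply (by fun_prop) hmeas]
        rfl
    _ ≤ (Measure.pi fun _ => (Measure.pi ν).prod uniformLabel).real
          {z | t ≤ ∑ j, (∑ k, v k * (z k).1 j) ^ 2} := by
        refine measureReal_mono fun z hz => ?_
        have hle := le_of_add_le_add_right (hz.trans (norm_sum_smul_cleanInput_le hU μ hv z))
        exact (Real.sqrt_le_sqrt_iff (by positivity)).1 hle
    _ ≤ Real.exp (-L) := hab hp hmean hnorm v hv L hL

end CleanDistribution

section DataMatrix

variable {ι E : Type*} [Fintype ι] [NormedAddCommGroup E] [NormedSpace ℝ E]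

/-- The operator `v ↦ ∑ k, v k • x k`, that is, the matrix with columns `x k`. For the inputs `x k`
it is the data matrix up to the signs of the columns. -/
noncomputable def columnMap (x : ι → E) : EuclideanSpace ℝ ι →L[ℝ] E :=
  ∑ k, (EuclideanSpace.proj k).smulRight (x k)

theorem columnMap_apply (x : ι → E) (v : EuclideanSpace ℝ ι) : columnMap x v = ∑ k, v k • x k := by
  simp [columnMap]

theorem topSingularValue_dataMatrix_le_opNorm {n p : ℕ}
    (S : Fin n → EuclideanSpace ℝ (Fin p) × ℤˣ) :
    topSingularValue (dataMatrix S) ≤ ‖columnMap fun k => (S k).1‖ := by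
  refine singularValues_le_of_norm_le _ (norm_nonneg _) (fun v => ?_) 0
  set w : EuclideanSpace ℝ (Fin n) := WithLp.toLp 2 fun k => labelVal (S k).2 * v k with hw
  have happly : Matrix.toEuclideanLin (dataMatrix S) v = columnMap (fun k => (S k).1) w := by
    ext i
    simp only [Matrix.toLpLin_apply, Matrix.mulVec, dotProduct, dataMatrix, Matrix.of_apply,
      columnMap_apply, hw, WithLp.ofLp_sum, Finset.sum_apply, PiLp.smul_apply, smul_eq_mul]
    exact Finset.sum_congr rfl fun k _ => by ring
  have hnorm : ‖w‖ = ‖v‖ := by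
    simp [EuclideanSpace.norm_eq, hw, abs_labelVal]
  rw [happly, ← hnorm]
  exact (columnMap fun k => (S k).1).le_opNorm w

theorem two_mul_le_sqrt_mul_one_add_sq_div {a p : ℝ} (hp : 0 < p) :
    2 * a ≤ Real.sqrt p * (1 + a ^ 2 / p) := by
  have hsq : Real.sqrt p * (1 + a ^ 2 / p) - 2 * a = (Real.sqrt p - a) ^ 2 / Real.sqrt p := by
    field_simp
    linear_combination a ^ 2 * Real.sq_sqrt hp.le
  exact sub_nonneg.1 (hsq ▸ by positivity)

theorem two_mul_sqrt_add_sqrt_mul_le {a b m s x p : ℝ} (hp : 0 < p) (hm : 0 ≤ m)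
    (h : 0 ≤ a * p + b * x) :
    2 * (Real.sqrt (a * p + b * x) + Real.sqrt m * s) ≤
      Real.sqrt p * (a + 2 + m * s ^ 2 / p + b / p * x) :=
  calc 2 * (Real.sqrt (a * p + b * x) + Real.sqrt m * s)
      = 2 * Real.sqrt (a * p + b * x) + 2 * (Real.sqrt m * s) := mul_add _ _ _
    _ ≤ Real.sqrt p * (1 + Real.sqrt (a * p + b * x) ^ 2 / p) +
          Real.sqrt p * (1 + (Real.sqrt m * s) ^ 2 / p) :=
        add_le_add (two_mul_le_sqrt_mul_one_add_sq_div hp) (two_mul_le_sqrt_mul_one_add_sq_div hp)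
    _ = Real.sqrt p * (a + 2 + m * s ^ 2 / p + b / p * x) := by
        rw [mul_pow, Real.sq_sqrt h, Real.sq_sqrt hm]
        field_simp
        ring

theorem natCast_mul_log_nine_add_log_pos (n : ℕ) {δ : ℝ} (hδ : 0 < δ) (hδ1 : δ < 1) :
    0 < n * Real.log 9 + Real.log (4 / δ) := by
  have : 0 < Real.log (4 / δ) := Real.log_pos ((one_lt_div hδ).2 (by linarith))
  positivity

theorem five_pow_mul_exp_neg_le (n : ℕ) {δ : ℝ} (hδ : 0 < δ) :
    5 ^ n * Real.exp (-(n * Real.log 9 + Real.log (4 / δ))) ≤ δ := by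
  have hexp : Real.exp (n * Real.log 9 + Real.log (4 / δ)) = 9 ^ n * (4 / δ) := by
    rw [Real.exp_add, Real.exp_nat_mul, Real.exp_log (by norm_num), Real.exp_log (by positivity)]
  have hpow : (5 : ℝ) ^ n ≤ 9 ^ n := by
    gcongr
    norm_num
  rw [Real.exp_neg, hexp, ← div_eq_mul_inv, div_le_iff₀ (by positivity)]
  calc (5 : ℝ) ^ n ≤ 4 * 9 ^ n := by linarith [pow_pos (by norm_num : (0 : ℝ) < 9) n]
    _ = δ * (9 ^ n * (4 / δ)) := by field_simp

theorem one_sub_le_measureReal_le_of_measureReal_lt_le {Ω : Type*} [MeasurableSpace Ω]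
    {P : Measure Ω} [IsProbabilityMeasure P] {f : Ω → ℝ} {t δ : ℝ} (h : P.real {ω | t < f ω} ≤ δ) :
    1 - δ ≤ P.real {ω | f ω ≤ t} := by
  have huniv : P.real Set.univ ≤ P.real {ω | f ω ≤ t} + P.real {ω | t < f ω} := by
    refine (measureReal_mono fun ω _ => ?_).trans (measureReal_union_le _ _)
    exact le_or_gt (f ω) t
  rw [probReal_univ] at huniv
  linarith

theorem sqrt_mul_add_le_sqrt_mul_add {a b m p s u w x : ℝ} (hm : 0 ≤ m)
    (hp : 0 ≤ p) (hu : 0 ≤ u) (hw : 0 ≤ w) (hx : 0 ≤ x) :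
    Real.sqrt p * (a + m * s ^ 2 / p + b / p * x) ≤
      Real.sqrt p * (a + 1 * Real.sqrt m / p * u + 2 * m * s ^ 2 / p +
        (b + 1 * w * Real.sqrt m) / p * x) := by
  have hmul : 0 ≤ Real.sqrt m / p * u + m * s ^ 2 / p + w * Real.sqrt m / p * x := by positivity
  gcongr _ * ?_
  calc a + m * s ^ 2 / p + b / p * x
      ≤ a + m * s ^ 2 / p + b / p * x +
          (Real.sqrt m / p * u + m * s ^ 2 / p + w * Real.sqrt m / p * x) :=
        le_add_of_nonneg_right hmul
    _ = _ := by ring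

theorem IsNoisyVersion.hasLaw_fst {E Ω : Type*} [MeasurableSpace E] [MeasurableSpace Ω] {η : ℝ}
    {Pc P : Measure (E × ℤˣ)} (hP : IsNoisyVersion η Pc P) {Pr : Measure Ω} {Z : Ω → E × ℤˣ}
    (hZ : HasLaw Z P Pr) : HasLaw (fun ω => (Z ω).1) (Pc.map Prod.fst) Pr :=
  HasLaw.comp ⟨measurable_fst.aemeasurable, hP.map_fst⟩ hZ

end DataMatrix

theorem proposition3_general {α : ℝ} (hα : 0 < α) (hα2 : α ≤ 2) :
    ∃ c c' : ℝ, 0 < c ∧ 0 < c' ∧ ∀ {n p : ℕ}, 0 < p → ∀ {ν : Fin p → Measure ℝ}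
      [∀ j, IsProbabilityMeasure (ν j)], (∀ j, ∫ x, x ∂(ν j) = 0) →
      (∀ j, orliczNorm α (fun x : ℝ => x) (ν j) ≤ 1) →
      ∀ {U : Matrix (Fin p) (Fin p) ℝ}, U ∈ Matrix.orthogonalGroup (Fin p) ℝ →
      ∀ {μ : EuclideanSpace ℝ (Fin p)} {Ω : Type*} [MeasurableSpace Ω] {Pr : Measure Ω}
        [IsProbabilityMeasure Pr] {S : Fin n → Ω → EuclideanSpace ℝ (Fin p) × ℤˣ},
      (∀ k, HasLaw (fun ω => (S k ω).1) ((cleanLaw ν U μ).map Prod.fst) Pr) →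
      iIndepFun (fun k ω => (S k ω).1) Pr → ∀ δ : ℝ, 0 < δ →
        1 - δ ≤ Pr.real {ω | topSingularValue (dataMatrix fun k => S k ω) ≤
          Real.sqrt p * (c + n * ‖μ‖ ^ 2 / p +
            c' / p * (n * Real.log 9 + Real.log (4 / δ)) ^ (2 / α))} := by
  obtain ⟨a, b, ha, hb, hab⟩ := exists_measureReal_norm_sum_smul_ge_le hα hα2
  refine ⟨a + 2, b, by linarith, hb,
    fun {n p} hp ν _ hmean hnorm U hU μ Ω _ Pr _ S hS hind δ hδ => ?_⟩
  rcases le_or_gt 1 δ with hδ1 | hδ1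
  · exact (sub_nonpos.2 hδ1).trans measureReal_nonneg
  set L := n * Real.log 9 + Real.log (4 / δ)
  have hL : 0 < L := natCast_mul_log_nine_add_log_pos n hδ hδ1
  set T := Real.sqrt (a * p + b * L ^ (2 / α)) + Real.sqrt n * ‖μ‖
  have hopNorm : Pr.real {ω | 2 * T < ‖columnMap fun k => (S k ω).1‖} ≤ δ :=
    calc Pr.real {ω | 2 * T < ‖columnMap fun k => (S k ω).1‖}
        ≤ 5 ^ Module.finrank ℝ (EuclideanSpace ℝ (Fin n)) * Real.exp (-L) :=
          measureReal_lt_opNorm_le (by positivity) fun v hv => by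
            simpa only [columnMap_apply] using hab hp hmean hnorm hU hS hind v hv L hL
      _ = 5 ^ n * Real.exp (-L) := by rw [finrank_euclideanSpace_fin]
      _ ≤ δ := five_pow_mul_exp_neg_le n hδ
  refine (one_sub_le_measureReal_le_of_measureReal_lt_le hopNorm).trans
    (measureReal_mono fun ω hω => ?_)
  rw [Set.mem_ofPred_eq] at hω ⊢
  calc topSingularValue (dataMatrix fun k => S k ω)
      ≤ ‖columnMap fun k => (S k ω).1‖ := topSingularValue_dataMatrix_le_opNorm _
    _ ≤ 2 * T := hω
    _ ≤ _ := two_mul_sqrt_add_sqrt_mul_le (Nat.cast_pos.2 hp) n.cast_nonneg (by positivity)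

theorem proposition3 (α : ℝ) (hα : 0 < α) (hα2 : α ≤ 2) :
    ∃ c₅ c₆ c₇ c₈ : ℝ, 0 < c₅ ∧ 0 < c₆ ∧ 0 < c₇ ∧ 0 < c₈ ∧
      ∀ (n p : ℕ), 0 < n → 0 < p →
      ∀ (κ : ℝ), 0 < κ →
      ∀ (ν : Fin p → Measure ℝ), IsClusterFamily α κ ν →
      ∀ (U : Matrix (Fin p) (Fin p) ℝ), U ∈ Matrix.orthogonalGroup (Fin p) ℝ →
      ∀ (μ : EuclideanSpace ℝ (Fin p)) (η : ℝ), 0 ≤ η → η ≤ 1 →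
      ∀ (P : Measure (EuclideanSpace ℝ (Fin p) × ℤˣ)), IsNoisyVersion η (cleanLaw ν U μ) P →
      ∀ (Ω : Type*) [MeasurableSpace Ω] (Pr : Measure Ω) [IsProbabilityMeasure Pr]
        (S : Fin n → Ω → EuclideanSpace ℝ (Fin p) × ℤˣ),
        (∀ k, HasLaw (S k) P Pr) → iIndepFun S Pr →
      ∀ (δ : ℝ), 0 < δ →
        1 - δ ≤ Pr.real {ω | topSingularValue (dataMatrix fun k => S k ω) ≤
          Real.sqrt p * (c₅ + c₆ * Real.sqrt n / p * ∑ i, |μ i| + 2 * n * ‖μ‖ ^ 2 / p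
            + (c₇ + c₈ * (⨆ i, |μ i|) * Real.sqrt n) / p
              * (n * Real.log 9 + Real.log (4 / δ)) ^ (2 / α))} := by
  obtain ⟨c, c', hc, hc', hgen⟩ := proposition3_general hα hα2
  refine ⟨c, 1, c', 1, hc, one_pos, hc', one_pos, ?_⟩
  intro n p _ hp κ _ ν hν U hU μ η _ _ P hP Ω _ Pr _ S hS hind δ hδ
  have := hν.isProbabilityMeasure
  rcases le_or_gt 1 δ with hδ1 | hδ1
  · exact (sub_nonpos.2 hδ1).trans measureReal_nonneg
  refine (hgen hp hν.mean_zero hν.orlicz_le hU (fun k => hP.hasLaw_fst (hS k))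
    (hind.comp _ fun _ => measurable_fst) δ hδ).trans (measureReal_mono fun ω hω => ?_)
  rw [Set.mem_ofPred_eq] at hω ⊢
  exact hω.trans (sqrt_mul_add_le_sqrt_mul_add n.cast_nonneg p.cast_nonneg
    (Finset.sum_nonneg fun i _ => abs_nonneg _) (Real.iSup_nonneg fun i => abs_nonneg _)
    (Real.rpow_nonneg (natCast_mul_log_nine_add_log_pos n hδ hδ1).le _))
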